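/- Let $d \ge 1$, $a_j < b_j$ for $j = 1,\dots,d$, $\Omega = \prod_{j=1}^d (a_j,b_j)$ and $L = \max_j (b_j - a_j)$. Let $\alpha \in (0,2)$ and $0 < \varepsilon \le 1 + \lfloor\alpha\rfloor - \alpha$. For $k\in\mathbb{N}\cup\{0\}$ and $s\in(0,1]$, $C^{k,s}(\mathbb{R}^d)$ is the space of functions with continuous partial derivatives of order at most $k$ whose $k$-th partial derivatives are uniformly Hölder continuous on $\mathbb{R}^d$ with exponent $s$. Let $$(-\Delta)^{\alpha/2}u(x) = c_{d,\alpha}\,\mathrm{P.V.}\!\int_{\mathbb{R}^d}\frac{u(x)-u(x')}{|x-x'|^{d+\alpha}}\,dx', \qquad c_{d,\alpha} = \frac{2^{\alpha-1}\alpha\,\Gamma((d+\alpha)/2)}{\sqrt{\pi^d}\,\Gamma(1-\alpha/2)}.$$ For $\gamma\in(\alpha,2]$ put $$\psi_\gamma(x,\xi) = |\xi|^{-\gamma}\Big(\sum_{\sigma\in\{0,1\}^d} u\big(x_1+(-1)^{\sigma_1}\xi_1,\dots,x_d+(-1)^{\sigma_d}\xi_d\big) - 2^d u(x)\Big), \qquad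 \omega_\gamma(\xi) = |\xi|^{\gamma-(d+\alpha)}.$$ For an integer $N\ge1$ and $h = L/N$ let $\xi_i = (i_1h,\dots,i_dh)$ and $I_i = \prod_j [i_jh,(i_j+1)h]$ for multi-indices $i$, let $D_2 = (0,\infty)^d\setminus(0,L)^d$, and for $m\in\{0,1\}^d\setminus\{0\}$ let $c_m^\gamma = 1$ if $\gamma<2$, while for $\gamma=2$ let $c_m^\gamma = 2^d/d$ if $m_1+\dots+m_d=1$ and $c_m^\gamma=0$ otherwise. The finite difference approximation is, for $x\in\Omega$, $$(-\Delta)^{\alpha/2}_{h,\gamma}u(x) = -\frac{c_{d,\alpha}}{2^d}\bigg[\sum_{i\in\{0,\dots,N-1\}^d\setminus\{0\}}\Big(\sum_{m\in\{0,1\}^d}\psi_\gamma(x,\xi_{i+m})\Big)\int_{I_i}\omega_\gamma\,d\xi + \Big(\sum_{m\in\{0,1\}^d\setminus\{0\}} c_m^\gamma\,\psi_\gamma(x,\xi_m)\Big)\int_{I_0}\omega_\gamma\,d\xi - 4^d u(x)\int_{D_2}|\xi|^{-(d+\alpha)}\,d\xi\bigg].$$ Suppose that $u:\mathbb{R}^d\to\mathbb{R}$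 vanishes outside $\Omega$ and that $u\in C^{\lfloor\alpha\rfloor,\,\alpha-\lfloor\alpha\rfloor+\varepsilon}(\mathbb{R}^d)$. Then for every splitting parameter $\gamma\in(\alpha,2]$ the principal value $(-\Delta)^{\alpha/2}u(x)$ exists for every $x\in\Omega$, and there is a constant $C>0$, independent of $h$, such that for all $h=L/N$, $N\ge1$, $$\sup_{x\in\Omega}\big|(-\Delta)^{\alpha/2}u(x) - (-\Delta)^{\alpha/2}_{h,\gamma}u(x)\big| \le C h^{\varepsilon}.$$ -/

import Mathlib

open MeasureTheory Filter Topology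

namespace FracFD

noncomputable section

/-- Euclidean space `ℝ^d`. -/
abbrev E (d : ℕ) := EuclideanSpace ℝ (Fin d)

/-- The space `C^{k,s}(ℝ^d)`: continuous partial derivatives of order at most `k`, those of order
`k` (together: the `k`-th derivative) being uniformly Hölder continuous on `ℝ^d` with
exponent `s`. -/
def IsHolderClass {d : ℕ} (k : ℕ) (s : ℝ) (u : E d → ℝ) : Prop :=
  ContDiff ℝ k u ∧
    ∃ K : ℝ, ∀ x y : E d,
      ‖iteratedFDeriv ℝ k u x - iteratedFDeriv ℝ k u y‖ ≤ K * ‖x - y‖ ^ s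

/-- The normalization constant `c_{d,α}` of the fractional Laplacian. -/
def fracConst (d : ℕ) (α : ℝ) : ℝ :=
  2 ^ (α - 1) * α * Real.Gamma ((d + α) / 2) /
    (Real.sqrt (Real.pi ^ d) * Real.Gamma (1 - α / 2))

/-- The integrand `x' ↦ (u(x) - u(x')) / |x - x'|^{d+α}`. -/
def fracIntegrand {d : ℕ} (α : ℝ) (u : E d → ℝ) (x x' : E d) : ℝ :=
  (u x - u x') / ‖x - x'‖ ^ ((d : ℝ) + α)

/-- `c_{d,α}` times the integral over the complement of the ball of radius `r` about `x`. -/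
def truncFracLaplacian {d : ℕ} (α : ℝ) (u : E d → ℝ) (x : E d) (r : ℝ) : ℝ :=
  fracConst d α * ∫ x' in {x' : E d | r < ‖x - x'‖}, fracIntegrand α u x x'

/-- The fractional Laplacian of `u` exists at `x` as a Cauchy principal value and equals `v`. -/
def HasFracLaplacianAt {d : ℕ} (α : ℝ) (u : E d → ℝ) (x : E d) (v : ℝ) : Prop :=
  (∀ r : ℝ, 0 < r → IntegrableOn (fracIntegrand α u x) {x' : E d | r < ‖x - x'‖}) ∧
    Tendsto (truncFracLaplacian α u x) (𝓝[>] 0) (𝓝 v)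

/-- The fractional Laplacian `(-Δ)^{α/2} u (x)`, the Cauchy principal value. -/
def fracLaplacian {d : ℕ} (α : ℝ) (u : E d → ℝ) (x : E d) : ℝ :=
  limUnder (𝓝[>] (0 : ℝ)) (truncFracLaplacian α u x)

/-- The open box `Ω = ∏ (a_j, b_j)`. -/
def box {d : ℕ} (a b : Fin d → ℝ) : Set (E d) := {x | ∀ j, a j < x j ∧ x j < b j}

/-- The largest side length `L = max_j (b_j - a_j)` of the box. -/
def maxSide {d : ℕ} (a b : Fin d → ℝ) : ℝ := ⨆ j, (b j - a j)

/-- The multi-indices in `{0, 1, …, n-1}^d`. -/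
def multiIdx (d n : ℕ) : Finset (Fin d → ℕ) := Fintype.piFinset fun _ => Finset.range n

/-- The grid point `ξ_i = (i_1 h, …, i_d h)`. -/
def gridPt {d : ℕ} (h : ℝ) (i : Fin d → ℕ) : E d := WithLp.toLp 2 fun j => (i j : ℝ) * h

/-- The element `I_i = ∏ [i_j h, (i_j + 1) h]`. -/
def cell {d : ℕ} (h : ℝ) (i : Fin d → ℕ) : Set (E d) :=
  {ξ | ∀ j, (i j : ℝ) * h ≤ ξ j ∧ ξ j ≤ ((i j : ℝ) + 1) * h}

/-- The far region `D_2 = (0,∞)^d \ (0,L)^d`. -/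
def farRegion (d : ℕ) (L : ℝ) : Set (E d) := {ξ | (∀ j, 0 < ξ j) ∧ ∃ j, L ≤ ξ j}

/-- The central difference quotient
`ψ_γ(x, ξ) = |ξ|^{-γ} (∑_{σ ∈ {0,1}^d} u(x_1 + (-1)^{σ_1} ξ_1, …, x_d + (-1)^{σ_d} ξ_d)
  - 2^d u(x))`. -/
def psi {d : ℕ} (γ : ℝ) (u : E d → ℝ) (x ξ : E d) : ℝ :=
  ((∑ σ ∈ multiIdx d 2, u (x + WithLp.toLp 2 fun j => (-1 : ℝ) ^ σ j * ξ j))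
    - 2 ^ d * u x) / ‖ξ‖ ^ γ

/-- The integral of the weight `ω_γ(ξ) = |ξ|^{γ-(d+α)}` over the element `I_i`. -/
def cellWeight {d : ℕ} (α γ h : ℝ) (i : Fin d → ℕ) : ℝ :=
  ∫ ξ in cell h i, ‖ξ‖ ^ (γ - ((d : ℝ) + α))

/-- The coefficients `c_m^γ` (for `m ∈ {0,1}^d`, `m ≠ 0`) used on the element at the origin:
`1` if `γ < 2`; if `γ = 2`, then `2^d / d` on the `d` unit vectors and `0` on the others. -/
def originCoeff {d : ℕ} (γ : ℝ) (m : Fin d → ℕ) : ℝ :=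
  if γ < 2 then 1 else if ∑ j, m j = 1 then 2 ^ d / d else 0

/-- The finite difference approximation `(-Δ)_{h,γ}^{α/2} u (x)` with `h = L / N`: the weighted
trapezoidal rule on each element `I_i`, `i ∈ {0,…,N-1}^d`, modified on the element at the origin,
and the exact integral over the far region. -/
def fdFracLaplacian {d : ℕ} (α γ L : ℝ) (N : ℕ) (u : E d → ℝ) (x : E d) : ℝ :=
  -(fracConst d α / 2 ^ d) *
    ((∑ i ∈ (multiIdx d N).filter (fun i => i ≠ 0),
        (∑ m ∈ multiIdx d 2, psi γ u x (gridPt (L / N) (i + m))) * cellWeight α γ (L / N) i)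
      + (∑ m ∈ (multiIdx d 2).filter (fun m => m ≠ 0),
          originCoeff γ m * psi γ u x (gridPt (L / N) m)) *
            cellWeight α γ (L / N) (0 : Fin d → ℕ)
      - 2 ^ d * 2 ^ d * u x * ∫ ξ in farRegion d L, ‖ξ‖ ^ (-((d : ℝ) + α)))

end

end FracFD

namespace FracFD

noncomputable section

/-! ### Integrals of powers of the norm -/

/-! Averaging over sign flips pairs `x + η` with `x - η`, so after folding onto the positive orthant
the integrand is `signSum u x ξ / ‖ξ‖ ^ (d + α)`. Put `s = α + ε ≤ 2`. The only regularity used is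
`HasSymmDiffBound s K u`, which makes `signSum` of size `‖ξ‖ ^ s`; the folded integrand is then
absolutely integrable, and the principal value exists by dominated convergence.

The orthant splits into the cells `I_i` and the far region. In the far region every shifted point
leaves the box, so the scheme is exact there. On the cell at the origin no cancellation is needed:
the exact integral and the quadrature term are each `O(h ^ ε)`.

On the other cells a first-order estimate loses a factor `‖ξ‖ / h`. Both the vertex sum and the
integral are therefore compared with the value of `psi` at the cell centre, and points symmetric
about the centre are paired. Only second differences of `psi`, and first differences multiplied by
`h / ‖c‖`, survive; both are `O(h ^ s * ‖c‖ ^ (-γ))` (`exists_psi_diff_bounds`). The cell error is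
thus at most a constant times `h ^ s` times the integral of `‖ξ‖ ^ (-(d + α))` over the cell
(`exists_cell_error_bound`). These cells lie in `h ≤ ‖ξ‖`, where that integral is a multiple of `h ^
(-α)`, so the errors sum to `O(h ^ ε)`. -/

lemma pow_smul_rpow {d : ℕ} (hd : 1 ≤ d) {y : ℝ} (hy : 0 < y) (e : ℝ) :
    y ^ (d - 1) • y ^ (e - (d : ℝ)) = y ^ (e - 1) := by
  rw [smul_eq_mul, ← Real.rpow_natCast, ← Real.rpow_add hy]
  congr 1
  push_cast [hd]
  ring

lemma nontrivial_E {d : ℕ} (hd : 1 ≤ d) : Nontrivial (E d) := by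
  have : Nonempty (Fin d) := ⟨⟨0, hd⟩⟩
  infer_instance

lemma indicator_Ici_norm {d : ℕ} (h : ℝ) (f : ℝ → ℝ) :
    (fun ξ : E d => (Set.Ici h).indicator f ‖ξ‖)
      = Set.indicator {ξ : E d | h ≤ ‖ξ‖} (fun ξ => f ‖ξ‖) := by
  ext ξ
  simp [Set.indicator]

lemma measurableSet_le_norm {d : ℕ} (h : ℝ) : MeasurableSet {ξ : E d | h ≤ ‖ξ‖} :=
  measurableSet_le measurable_const measurable_norm

lemma smul_indicator_Ici {d : ℕ} (hd : 1 ≤ d) (α : ℝ) {h : ℝ} :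
    Set.EqOn (fun y : ℝ => y ^ (d - 1) • (Set.Ici h).indicator (fun r => r ^ (-((d : ℝ) + α))) y)
      ((Set.Ici h).indicator fun y => y ^ (-α - 1)) (Set.Ioi 0) := by
  intro y hy
  by_cases hy' : h ≤ y
  · have : -((d : ℝ) + α) = -α - d := by ring
    simp only [Set.indicator, Set.mem_Ici, hy', if_true, this]
    exact pow_smul_rpow hd hy _
  · simp [Set.indicator, hy']

lemma Ioi_inter_Ici {h : ℝ} (hh : 0 < h) : Set.Ioi (0 : ℝ) ∩ Set.Ici h = Set.Ici h :=
  Set.inter_eq_right.2 fun _ hy => hh.trans_le hy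

lemma integrableOn_norm_rpow_le {d : ℕ} (hd : 1 ≤ d) {α : ℝ} (hα : 0 < α) {h : ℝ} (hh : 0 < h) :
    IntegrableOn (fun ξ : E d => ‖ξ‖ ^ (-((d : ℝ) + α))) {ξ : E d | h ≤ ‖ξ‖} := by
  have := nontrivial_E hd
  rw [← integrable_indicator_iff (measurableSet_le_norm h),
    ← indicator_Ici_norm h fun r => r ^ (-((d : ℝ) + α)), integrable_fun_norm_addHaar,
    finrank_euclideanSpace_fin, integrableOn_congr_fun (smul_indicator_Ici hd α) measurableSet_Ioi,
    IntegrableOn, integrable_indicator_iff measurableSet_Ici, IntegrableOn,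
    Measure.restrict_restrict measurableSet_Ici, Set.inter_comm, Ioi_inter_Ici hh]
  exact (integrableOn_Ici_iff_integrableOn_Ioi).2 (integrableOn_Ioi_rpow_of_lt (by linarith) hh)

/-- Polar coordinates. This scaling law is what turns the local rate `h ^ (α + ε)` into the global
rate `h ^ ε`. -/
lemma exists_integral_norm_rpow_le {d : ℕ} (hd : 1 ≤ d) {α : ℝ} (hα : 0 < α) :
    ∃ C : ℝ, 0 ≤ C ∧ ∀ h : ℝ, 0 < h →
      ∫ ξ in {ξ : E d | h ≤ ‖ξ‖}, ‖ξ‖ ^ (-((d : ℝ) + α)) = C * h ^ (-α) := by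
  have := nontrivial_E hd
  refine ⟨d * ((volume : Measure (E d)).real (Metric.ball 0 1) * α⁻¹), by positivity,
    fun h hh => ?_⟩
  rw [← integral_indicator (measurableSet_le_norm h),
    ← indicator_Ici_norm h fun r => r ^ (-((d : ℝ) + α)), integral_fun_norm_addHaar,
    finrank_euclideanSpace_fin, setIntegral_congr_fun measurableSet_Ioi (smul_indicator_Ici hd α),
    setIntegral_indicator measurableSet_Ici, Ioi_inter_Ici hh, integral_Ici_eq_integral_Ioi,
    integral_Ioi_rpow_of_lt (by linarith) hh]
  simp only [nsmul_eq_mul, smul_eq_mul]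
  rw [show -α - 1 + 1 = -α by ring]
  field_simp

lemma smul_indicator_Iio {d : ℕ} (hd : 1 ≤ d) (e : ℝ) {R : ℝ} :
    Set.EqOn (fun y : ℝ => y ^ (d - 1) • (Set.Iio R).indicator (fun r => r ^ (e - (d : ℝ))) y)
      ((Set.Iio R).indicator fun y => y ^ (e - 1)) (Set.Ioi 0) := by
  intro y hy
  by_cases hy' : y < R
  · simp only [Set.indicator, Set.mem_Iio, hy', if_true]
    exact pow_smul_rpow hd hy _
  · simp [Set.indicator, hy']

lemma indicator_Iio_norm {d : ℕ} (R : ℝ) (f : ℝ → ℝ) :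
    (fun ξ : E d => (Set.Iio R).indicator f ‖ξ‖)
      = Set.indicator (Metric.ball (0 : E d) R) (fun ξ => f ‖ξ‖) := by
  ext ξ
  simp [Set.indicator]

lemma integrableOn_ball_norm_rpow {d : ℕ} (hd : 1 ≤ d) {e : ℝ} (he : 0 < e) {R : ℝ} (hR : 0 < R) :
    IntegrableOn (fun ξ : E d => ‖ξ‖ ^ (e - (d : ℝ))) (Metric.ball 0 R) := by
  have := nontrivial_E hd
  rw [integrableOn_fun_norm_addHaar volume (f := fun r : ℝ => r ^ (e - (d : ℝ))),
    finrank_euclideanSpace_fin, integrableOn_congr_fun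
      (fun y hy => pow_smul_rpow hd hy.1 e) measurableSet_Ioo,
    intervalIntegral.integrableOn_Ioo_rpow_iff hR]
  linarith

lemma exists_integral_ball_norm_rpow {d : ℕ} (hd : 1 ≤ d) {e : ℝ} (he : 0 < e) :
    ∃ C : ℝ, 0 ≤ C ∧ ∀ R : ℝ, 0 < R →
      ∫ ξ in Metric.ball (0 : E d) R, ‖ξ‖ ^ (e - (d : ℝ)) = C * R ^ e := by
  have := nontrivial_E hd
  refine ⟨d * ((volume : Measure (E d)).real (Metric.ball 0 1) * e⁻¹), by positivity,
    fun R hR => ?_⟩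
  rw [← integral_indicator Metric.isOpen_ball.measurableSet,
    ← indicator_Iio_norm R fun r => r ^ (e - (d : ℝ)), integral_fun_norm_addHaar,
    finrank_euclideanSpace_fin, setIntegral_congr_fun measurableSet_Ioi (smul_indicator_Iio hd e),
    setIntegral_indicator measurableSet_Iio, Set.Ioi_inter_Iio, ← integral_Ioc_eq_integral_Ioo,
    ← intervalIntegral.integral_of_le hR.le, integral_rpow (Or.inl (by linarith))]
  simp only [nsmul_eq_mul, smul_eq_mul]
  rw [show e - 1 + 1 = e by ring, Real.zero_rpow he.ne']
  field_simp
  ring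

/-! ### Elementary estimates for powers -/

/-- First-order Taylor estimate with quadratic remainder for `t ↦ t ^ (-a)`, `0 ≤ a ≤ 1`. -/
lemma abs_rpow_neg_sub_taylor_le {a : ℝ} (ha0 : 0 ≤ a) (ha1 : a ≤ 1) {t κ : ℝ} (ht : 0 < t)
    (hκ : t⁻¹ ≤ κ) : |t ^ (-a) - (1 - a * (t - 1))| ≤ κ * (t - 1) ^ 2 := by
  have hti : 0 < t⁻¹ := inv_pos.2 ht
  -- Bernoulli's inequality at `t`, once inverted, bounds `t ^ (-a)` from below; at `t⁻¹` it bounds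
  -- it from above. Both need `0 ≤ a ≤ 1`.
  have h1 : t ^ a ≤ 1 + a * (t - 1) := by
    have := rpow_one_add_le_one_add_mul_self (s := t - 1) (by linarith) ha0 ha1
    simpa using this
  have h2 : (t⁻¹) ^ a ≤ 1 + a * (t⁻¹ - 1) := by
    have := rpow_one_add_le_one_add_mul_self (s := t⁻¹ - 1) (by linarith) ha0 ha1
    simpa using this
  have h3 : t ^ (-a) = (t⁻¹) ^ a := by rw [Real.rpow_neg ht.le, Real.inv_rpow ht.le]
  have hpos : 0 < t ^ a := Real.rpow_pos_of_pos ht a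
  have hlow : 1 - a * (t - 1) ≤ t ^ (-a) := by
    rw [Real.rpow_neg ht.le]
    have h4 : (1 + a * (t - 1))⁻¹ ≤ (t ^ a)⁻¹ := inv_anti₀ hpos h1
    have h5 : 0 < 1 + a * (t - 1) := hpos.trans_le h1
    have h6 : 1 - a * (t - 1) ≤ (1 + a * (t - 1))⁻¹ := by
      rw [← one_div, le_div_iff₀ h5]
      nlinarith [sq_nonneg (a * (t - 1))]
    exact h6.trans h4
  have hkey : 1 + a * (t⁻¹ - 1) = 1 - a * (t - 1) + a * (t⁻¹ * (t - 1) ^ 2) := by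
    field_simp
    ring
  have hq : t⁻¹ * (t - 1) ^ 2 ≤ κ * (t - 1) ^ 2 := by gcongr
  have hq0 : 0 ≤ t⁻¹ * (t - 1) ^ 2 := by positivity
  rw [abs_of_nonneg (by linarith)]
  nlinarith

/-- `t ↦ t ^ b` is Lipschitz at `1` on compact subintervals of `(0, ∞)`. -/
lemma exists_abs_rpow_sub_one_le (b : ℝ) {κ : ℝ} (hκ : 1 ≤ κ) :
    ∃ C : ℝ, 0 ≤ C ∧ ∀ t : ℝ, κ⁻¹ ≤ t → t ≤ κ → |t ^ b - 1| ≤ C * |t - 1| := by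
  have hκ0 : 0 < κ⁻¹ := by positivity
  have hpos : ∀ t ∈ Set.Icc κ⁻¹ κ, 0 < t := fun t ht => hκ0.trans_le ht.1
  have hcont : ContinuousOn (fun t : ℝ => b * t ^ (b - 1)) (Set.Icc κ⁻¹ κ) :=
    continuousOn_const.mul (continuousOn_id.rpow_const fun t ht => Or.inl (hpos t ht).ne')
  obtain ⟨C, hC⟩ := isCompact_Icc.exists_bound_of_continuousOn hcont
  have h1 : (1 : ℝ) ∈ Set.Icc κ⁻¹ κ := ⟨inv_le_one_of_one_le₀ hκ, hκ⟩
  refine ⟨C, (norm_nonneg _).trans (hC 1 h1), fun t ht1 ht2 => ?_⟩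
  have := (convex_Icc κ⁻¹ κ).norm_image_sub_le_of_norm_hasDerivWithin_le
    (f := fun t : ℝ => t ^ b) (f' := fun t => b * t ^ (b - 1))
    (fun x hx => (Real.hasDerivAt_rpow_const (Or.inl (hpos x hx).ne')).hasDerivWithinAt)
    hC h1 ⟨ht1, ht2⟩
  simpa using this

/-! ### The central second difference of `u` -/

/-- The second-difference regularity satisfied by the functions of Hölder order `s ∈ (0, 2]`. -/
def HasSymmDiffBound {d : ℕ} (s K : ℝ) (u : E d → ℝ) : Prop :=
  ∀ (x ξ z : E d) (h : ℝ), 0 < h → ‖z‖ ≤ h →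
    |(u (x + (ξ + z)) + u (x - (ξ + z))) - (u (x + ξ) + u (x - ξ))| ≤ K * (h ^ (s - 1) * (‖ξ‖ + h))

/-- Hölder continuity of each term already gives `h ^ s`; this is weakened to `h ^ (s - 1) * (‖ξ‖ +
h)` so that orders below and above one share one form. -/
lemma IsHolderClass.hasSymmDiffBound_zero {d : ℕ} {s : ℝ} (hs0 : 0 < s) {u : E d → ℝ}
    (hu : IsHolderClass 0 s u) : ∃ K : ℝ, 0 ≤ K ∧ HasSymmDiffBound s K u := by
  obtain ⟨-, K, hK⟩ := hu
  have hK' : ∀ x y : E d, |u x - u y| ≤ |K| * ‖x - y‖ ^ s := by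
    intro x y
    have h1 := hK x y
    rw [iteratedFDeriv_zero_eq_comp] at h1
    simp only [Function.comp_apply] at h1
    rw [← map_sub, LinearIsometryEquiv.norm_map, Real.norm_eq_abs] at h1
    refine h1.trans ?_
    gcongr
    exact le_abs_self K
  refine ⟨2 * |K|, by positivity, fun x ξ z h hh hz => ?_⟩
  have h1 := hK' (x + (ξ + z)) (x + ξ)
  have h2 := hK' (x - (ξ + z)) (x - ξ)
  rw [show x + (ξ + z) - (x + ξ) = z by abel] at h1
  rw [show x - (ξ + z) - (x - ξ) = -z by abel, norm_neg] at h2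
  have h3 : ‖z‖ ^ s ≤ h ^ s := by gcongr
  have h4 : h ^ s ≤ h ^ (s - 1) * (‖ξ‖ + h) := by
    have : h ^ s = h ^ (s - 1) * h := by
      rw [← Real.rpow_add_one hh.ne']; ring_nf
    rw [this]
    have := norm_nonneg ξ
    gcongr
    linarith
  calc _ = |(u (x + (ξ + z)) - u (x + ξ)) + (u (x - (ξ + z)) - u (x - ξ))| := by ring_nf
    _ ≤ |K| * ‖z‖ ^ s + |K| * ‖z‖ ^ s := (abs_add_le _ _).trans (add_le_add h1 h2)
    _ = 2 * |K| * ‖z‖ ^ s := by ring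
    _ ≤ _ := by gcongr; exact h3.trans h4

/-- Mean value inequality for `η ↦ u (x + η) + u (x - η)`: its derivative at `y` is a difference of
derivatives of `u` at distance `2 * ‖y‖`, hence small by Hölder continuity. -/
lemma IsHolderClass.hasSymmDiffBound_one {d : ℕ} {s : ℝ} (hs1 : 1 ≤ s) (hs2 : s ≤ 2) {u : E d → ℝ}
    (hu : IsHolderClass 1 (s - 1) u) : ∃ K : ℝ, 0 ≤ K ∧ HasSymmDiffBound s K u := by
  obtain ⟨hc, K, hK⟩ := hu
  have hdiff : Differentiable ℝ u := hc.differentiable (by norm_num)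
  have hK' : ∀ x y : E d, ‖fderiv ℝ u x - fderiv ℝ u y‖ ≤ |K| * ‖x - y‖ ^ (s - 1) := by
    intro x y
    refine ContinuousLinearMap.opNorm_le_bound _ (by positivity) fun v => ?_
    have h1 : (fderiv ℝ u x - fderiv ℝ u y) v
        = (iteratedFDeriv ℝ 1 u x - iteratedFDeriv ℝ 1 u y) fun _ => v := by
      simp [iteratedFDeriv_one_apply]
    rw [h1]
    refine (ContinuousMultilinearMap.le_opNorm _ _).trans ?_
    simp only [Finset.prod_const, Finset.card_univ, Fintype.card_fin, pow_one]
    gcongr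
    refine (hK x y).trans ?_
    gcongr
    exact le_abs_self K
  refine ⟨2 * |K|, by positivity, fun x ξ z h hh hz => ?_⟩
  have hder : ∀ y : E d, HasFDerivAt (fun η => u (x + η) + u (x - η))
      (fderiv ℝ u (x + y) - fderiv ℝ u (x - y)) y := by
    intro y
    have h1 : HasFDerivAt (fun η => u (x + η)) (fderiv ℝ u (x + y)) y := by
      have h := (hdiff (x + y)).hasFDerivAt.comp y ((hasFDerivAt_id y).const_add x)
      rw [ContinuousLinearMap.comp_id] at h
      exact h
    have h2 : HasFDerivAt (fun η => u (x - η)) (-fderiv ℝ u (x - y)) y := by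
      have h := (hdiff (x - y)).hasFDerivAt.comp y ((hasFDerivAt_id y).const_sub x)
      rw [ContinuousLinearMap.comp_neg, ContinuousLinearMap.comp_id] at h
      exact h
    rw [sub_eq_add_neg]
    exact h1.add h2
  have hle : ∀ y ∈ segment ℝ ξ (ξ + z), ‖fderiv ℝ u (x + y) - fderiv ℝ u (x - y)‖
      ≤ 2 * |K| * (‖ξ‖ + h) ^ (s - 1) := by
    intro y hy
    have hy1 : ‖y‖ ≤ ‖ξ‖ + h := by
      have := (convex_closedBall (0 : E d) (‖ξ‖ + h)).segment_subset (x := ξ) (y := ξ + z)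
        (by simp [hh.le]) (by simpa using (norm_add_le ξ z).trans (by linarith)) hy
      simpa using this
    refine (hK' _ _).trans ?_
    have h1 : ‖x + y - (x - y)‖ ≤ 2 * (‖ξ‖ + h) := by
      rw [show x + y - (x - y) = y + y by abel]
      exact (norm_add_le _ _).trans (by linarith)
    have h0 : 0 ≤ ‖ξ‖ + h := by positivity
    calc |K| * ‖x + y - (x - y)‖ ^ (s - 1) ≤ |K| * (2 * (‖ξ‖ + h)) ^ (s - 1) := by
          gcongr
      _ = |K| * (2 ^ (s - 1) * (‖ξ‖ + h) ^ (s - 1)) := by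
          rw [Real.mul_rpow (by norm_num) h0]
      _ ≤ |K| * (2 * (‖ξ‖ + h) ^ (s - 1)) := by
          gcongr
          calc (2 : ℝ) ^ (s - 1) ≤ 2 ^ (1 : ℝ) :=
                Real.rpow_le_rpow_of_exponent_le (by norm_num) (by linarith)
            _ = 2 := by norm_num
      _ = _ := by ring
  have hmv := (convex_segment ξ (ξ + z)).norm_image_sub_le_of_norm_hasFDerivWithin_le
    (fun y _ => (hder y).hasFDerivWithinAt) hle (left_mem_segment ℝ _ _) (right_mem_segment ℝ _ _)
  rw [Real.norm_eq_abs] at hmv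
  refine hmv.trans ?_
  rw [add_sub_cancel_left, mul_assoc (2 * |K|)]
  refine mul_le_mul_of_nonneg_left ?_ (by positivity)
  have hp : 0 < ‖ξ‖ + h := by positivity
  have e1 : (‖ξ‖ + h) ^ (s - 1) = (‖ξ‖ + h) ^ (s - 2) * (‖ξ‖ + h) := by
    rw [← Real.rpow_add_one hp.ne']; ring_nf
  have e2 : h ^ (s - 1) = h ^ (s - 2) * h := by
    rw [← Real.rpow_add_one hh.ne']; ring_nf
  -- The exponent `s - 2` is nonpositive, so one factor `‖ξ‖ + h` can be kept and the rest replaced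
  -- by a power of `h`.
  have e3 : (‖ξ‖ + h) ^ (s - 2) ≤ h ^ (s - 2) :=
    Real.rpow_le_rpow_of_nonpos hh (by linarith [norm_nonneg ξ]) (by linarith)
  rw [e1, e2]
  calc (‖ξ‖ + h) ^ (s - 2) * (‖ξ‖ + h) * ‖z‖ ≤ h ^ (s - 2) * (‖ξ‖ + h) * h := by gcongr
    _ = _ := by ring

/-! ### Sign flips and the symmetrized sum -/

/-- The coordinate reflection `ξ ↦ ((-1)^{σ_1} ξ_1, …, (-1)^{σ_d} ξ_d)`. -/
def signFlip {d : ℕ} (σ : Fin d → ℕ) : E d ≃ₗᵢ[ℝ] E d where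
  toFun ξ := WithLp.toLp 2 fun j => (-1 : ℝ) ^ σ j * ξ j
  invFun ξ := WithLp.toLp 2 fun j => (-1 : ℝ) ^ σ j * ξ j
  map_add' ξ η := by ext j; simp [mul_add]
  map_smul' c ξ := by ext j; simp; ring
  left_inv ξ := by ext j; simp [← mul_assoc, ← mul_pow]
  right_inv ξ := by ext j; simp [← mul_assoc, ← mul_pow]
  norm_map' ξ := by simp [EuclideanSpace.norm_eq]

lemma signFlip_apply {d : ℕ} (σ : Fin d → ℕ) (ξ : E d) (j : Fin d) :
    signFlip σ ξ j = (-1 : ℝ) ^ σ j * ξ j := rfl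

lemma mem_multiIdx {d n : ℕ} {i : Fin d → ℕ} : i ∈ multiIdx d n ↔ ∀ j, i j < n := by
  simp [multiIdx]

lemma card_multiIdx (d n : ℕ) : (multiIdx d n).card = n ^ d := by
  simp [multiIdx]

/-- Reindexing a sum over `{0,1}^d` by `σ ↦ 1 - σ`. -/
lemma sum_multiIdx_two_reflect {d : ℕ} (g : (Fin d → ℕ) → ℝ) :
    ∑ σ ∈ multiIdx d 2, g (fun j => 1 - σ j) = ∑ σ ∈ multiIdx d 2, g σ := by
  have hmem : ∀ σ ∈ multiIdx d 2, (fun j => 1 - σ j) ∈ multiIdx d 2 := fun σ _ =>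
    mem_multiIdx.2 fun j => by omega
  have hinv : ∀ σ ∈ multiIdx d 2, (fun j => 1 - (1 - σ j)) = σ := fun σ hσ => by
    ext j
    have := mem_multiIdx.1 hσ j
    omega
  exact Finset.sum_nbij' (fun σ j => 1 - σ j) (fun σ j => 1 - σ j) hmem hmem hinv hinv
    fun _ _ => rfl

lemma signFlip_reflect {d : ℕ} {σ : Fin d → ℕ} (hσ : σ ∈ multiIdx d 2) (ξ : E d) :
    signFlip (fun j => 1 - σ j) ξ = -signFlip σ ξ := by
  ext j
  have := mem_multiIdx.1 hσ j
  rw [signFlip_apply, PiLp.neg_apply, signFlip_apply]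
  interval_cases σ j <;> simp

/-- The numerator of the central difference quotient `psi`. -/
def signSum {d : ℕ} (u : E d → ℝ) (x ξ : E d) : ℝ :=
  (∑ σ ∈ multiIdx d 2, u (x + signFlip σ ξ)) - 2 ^ d * u x

lemma psi_eq_signSum_div {d : ℕ} (γ : ℝ) (u : E d → ℝ) (x ξ : E d) :
    psi γ u x ξ = signSum u x ξ / ‖ξ‖ ^ γ := rfl

lemma signSum_eq_sum {d : ℕ} (u : E d → ℝ) (x ξ : E d) :
    signSum u x ξ = ∑ σ ∈ multiIdx d 2, (u (x + signFlip σ ξ) - u x) := by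
  rw [signSum, Finset.sum_sub_distrib, Finset.sum_const, card_multiIdx]
  simp

/-- Complementing `σ` negates the flip, so the sum is made of central pairs and odd-order terms of
`u` cancel. -/
lemma two_mul_sum_signFlip {d : ℕ} (u : E d → ℝ) (x ξ : E d) :
    2 * ∑ σ ∈ multiIdx d 2, u (x + signFlip σ ξ)
      = ∑ σ ∈ multiIdx d 2, (u (x + signFlip σ ξ) + u (x - signFlip σ ξ)) := by
  rw [two_mul, Finset.sum_add_distrib]
  congr 1
  rw [← sum_multiIdx_two_reflect]
  refine Finset.sum_congr rfl fun σ hσ => ?_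
  rw [signFlip_reflect hσ, sub_eq_add_neg]

lemma abs_sum_multiIdx_two_le {d : ℕ} {g : (Fin d → ℕ) → ℝ} {B : ℝ}
    (hg : ∀ σ ∈ multiIdx d 2, |g σ| ≤ B) : |∑ σ ∈ multiIdx d 2, g σ| ≤ 2 ^ d * B := by
  refine (Finset.abs_sum_le_sum_abs _ _).trans ((Finset.sum_le_sum hg).trans ?_)
  rw [Finset.sum_const, card_multiIdx]
  simp

lemma HasSymmDiffBound.abs_signSum_add_sub_le {d : ℕ} {s K : ℝ} {u : E d → ℝ}
    (hu : HasSymmDiffBound s K u) (x ξ z : E d) {h : ℝ} (hh : 0 < h) (hz : ‖z‖ ≤ h) :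
    |signSum u x (ξ + z) - signSum u x ξ| ≤ 2 ^ d * (K * (h ^ (s - 1) * (‖ξ‖ + h))) := by
  have h1 : 2 * (signSum u x (ξ + z) - signSum u x ξ)
      = ∑ σ ∈ multiIdx d 2, ((u (x + signFlip σ (ξ + z)) + u (x - signFlip σ (ξ + z)))
        - (u (x + signFlip σ ξ) + u (x - signFlip σ ξ))) := by
    rw [Finset.sum_sub_distrib, ← two_mul_sum_signFlip, ← two_mul_sum_signFlip]
    simp only [signSum]
    ring
  have h2 : |2 * (signSum u x (ξ + z) - signSum u x ξ)|
      ≤ 2 ^ d * (K * (h ^ (s - 1) * (‖ξ‖ + h))) := by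
    rw [h1]
    refine abs_sum_multiIdx_two_le fun σ _ => ?_
    have := hu x (signFlip σ ξ) (signFlip σ z) h hh (by simpa using hz)
    rwa [LinearIsometryEquiv.norm_map, ← map_add] at this
  rw [abs_mul, abs_two] at h2
  linarith [abs_nonneg (signSum u x (ξ + z) - signSum u x ξ)]

lemma signSum_zero {d : ℕ} (u : E d → ℝ) (x : E d) : signSum u x 0 = 0 := by
  simp [signSum_eq_sum]

lemma rpow_sub_one_mul {h : ℝ} (hh : 0 < h) (s : ℝ) : h ^ (s - 1) * h = h ^ s := by
  rw [← Real.rpow_add_one hh.ne']; ring_nf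

/-- The increment bound started at the origin, with step length `‖ξ‖` itself. -/
lemma HasSymmDiffBound.abs_signSum_le {d : ℕ} {s K : ℝ} (hs : 0 < s) {u : E d → ℝ}
    (hu : HasSymmDiffBound s K u) (x ξ : E d) : |signSum u x ξ| ≤ 2 ^ d * (K * ‖ξ‖ ^ s) := by
  rcases eq_or_ne ξ 0 with rfl | hξ
  · simp [signSum_zero, Real.zero_rpow hs.ne']
  · have hξ' : 0 < ‖ξ‖ := norm_pos_iff.2 hξ
    have := hu.abs_signSum_add_sub_le x 0 ξ hξ' le_rfl
    simpa [signSum_zero, rpow_sub_one_mul hξ'] using this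

/-- The regularity bound is applied around each shifted point `x + signFlip σ ξ` with base
displacement zero; this removes the growth in `‖ξ‖` and leaves a pure `h ^ s`. -/
lemma HasSymmDiffBound.abs_signSum_second_diff_le {d : ℕ} {s K : ℝ} {u : E d → ℝ}
    (hu : HasSymmDiffBound s K u) (x ξ z : E d) {h : ℝ} (hh : 0 < h) (hz : ‖z‖ ≤ h) :
    |signSum u x (ξ + z) + signSum u x (ξ - z) - 2 * signSum u x ξ| ≤ 2 ^ d * (K * h ^ s) := by
  have h1 : signSum u x (ξ + z) + signSum u x (ξ - z) - 2 * signSum u x ξ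
      = ∑ σ ∈ multiIdx d 2, ((u (x + signFlip σ (ξ + z)) + u (x + signFlip σ (ξ - z)))
        - 2 * u (x + signFlip σ ξ)) := by
    rw [Finset.sum_sub_distrib, Finset.sum_add_distrib, ← Finset.mul_sum]
    simp only [signSum]
    ring
  rw [h1]
  refine abs_sum_multiIdx_two_le fun σ _ => ?_
  have := hu (x + signFlip σ ξ) 0 (signFlip σ z) h hh (by simpa using hz)
  rw [norm_zero, zero_add, zero_add, rpow_sub_one_mul hh, add_zero, sub_zero, ← two_mul] at this
  rwa [map_add, map_sub, ← add_assoc, ← add_sub_assoc]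

lemma abs_signSum_le_of_bounded {d : ℕ} {u : E d → ℝ} {M : ℝ} (hM : ∀ y, |u y| ≤ M) (x ξ : E d) :
    |signSum u x ξ| ≤ 2 ^ d * (2 * M) := by
  rw [signSum_eq_sum]
  refine abs_sum_multiIdx_two_le fun σ _ => ?_
  linarith [abs_sub (u (x + signFlip σ ξ)) (u x), hM x, hM (x + signFlip σ ξ)]

lemma continuous_signSum {d : ℕ} {u : E d → ℝ} (hu : Continuous u) (x : E d) :
    Continuous (signSum u x) :=
  (continuous_finsetSum _ fun σ _ => hu.comp (continuous_const.add (signFlip σ).continuous)).sub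
    continuous_const

/-! ### Null sets and orthants -/

lemma measurable_coord {d : ℕ} (j : Fin d) : Measurable fun ξ : E d => ξ j :=
  (PiLp.continuous_apply 2 (fun _ : Fin d => ℝ) j).measurable

lemma ae_coord_ne {d : ℕ} (c : Fin d → ℝ) : ∀ᵐ ξ : E d, ∀ j, ξ j ≠ c j := by
  rw [ae_all_iff]
  intro j
  have h : ∀ᵐ y : Fin d → ℝ, y j ≠ c j := 
    Measure.ae_eval_ne (fun _ : Fin d => (volume : Measure ℝ)) j (c j)
  exact (PiLp.volume_preserving_ofLp (Fin d)).quasiMeasurePreserving.ae h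

/-- The open positive orthant. -/
def posOrthant (d : ℕ) : Set (E d) := {ξ | ∀ j, 0 < ξ j}

lemma measurableSet_posOrthant (d : ℕ) : MeasurableSet (posOrthant d) := by
  have : posOrthant d = ⋂ j, {ξ : E d | 0 < ξ j} := by ext; simp [posOrthant]
  rw [this]
  exact MeasurableSet.iInter fun j => measurableSet_lt measurable_const (measurable_coord j)

lemma measurePreserving_signFlip {d : ℕ} (σ : Fin d → ℕ) :
    MeasurePreserving (signFlip σ : E d → E d) := (signFlip σ).measurePreserving

lemma measurableEmbedding_signFlip {d : ℕ} (σ : Fin d → ℕ) :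
    MeasurableEmbedding (signFlip σ : E d → E d) :=
  (signFlip σ).toHomeomorph.measurableEmbedding

lemma signFlip_signFlip {d : ℕ} (σ : Fin d → ℕ) (ξ : E d) : signFlip σ (signFlip σ ξ) = ξ :=
  (signFlip σ).left_inv ξ

lemma neg_one_pow_mul_pos_eq {a b : ℕ} (ha : a < 2) (hb : b < 2) {t : ℝ}
    (h1 : 0 < (-1 : ℝ) ^ a * t) (h2 : 0 < (-1 : ℝ) ^ b * t) : a = b := by
  interval_cases a <;> interval_cases b <;> simp at * <;> linarith

/-- Folding an integral over the whole space onto the positive orthant. -/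
lemma integral_eq_posOrthant {d : ℕ} {g : E d → ℝ} (hg : Integrable g) :
    ∫ y, g y = ∫ y in posOrthant d, ∑ σ ∈ multiIdx d 2, g (signFlip σ y) := by
  have hmeas : ∀ σ : Fin d → ℕ, MeasurableSet (signFlip σ ⁻¹' posOrthant d) := fun σ =>
    (measurableSet_posOrthant d).preimage (measurePreserving_signFlip σ).measurable
  have hcover : (⋃ σ ∈ multiIdx d 2, signFlip σ ⁻¹' posOrthant d : Set (E d)) =ᵐ[volume]
      (Set.univ : Set (E d)) := by
    refine Filter.eventuallyEq_univ.2 ?_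
    filter_upwards [ae_coord_ne (fun _ : Fin d => 0)] with y hy
    -- The signs of the coordinates of `y` select its orthant; coordinate hyperplanes are null.
    refine Set.mem_biUnion (x := fun j => if 0 < y j then 0 else 1)
      (mem_multiIdx.2 fun j => by split_ifs <;> norm_num) fun j => ?_
    rw [signFlip_apply]
    by_cases hj : 0 < y j
    · simp [hj]
    · simpa [hj] using lt_of_le_of_ne (not_lt.1 hj) (hy j)
  have hdisj : Set.PairwiseDisjoint (↑(multiIdx d 2) : Set (Fin d → ℕ))
      fun σ => (signFlip σ ⁻¹' posOrthant d : Set (E d)) := by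
    intro σ hσ τ hτ hne
    refine Set.disjoint_left.2 fun y hy1 hy2 => hne ?_
    ext j
    exact neg_one_pow_mul_pos_eq (mem_multiIdx.1 hσ j) (mem_multiIdx.1 hτ j) (hy1 j) (hy2 j)
  rw [← setIntegral_univ, ← setIntegral_congr_set hcover,
    integral_biUnion_finset _ (fun σ _ => hmeas σ) hdisj fun σ _ => hg.integrableOn,
    integral_finsetSum _ fun σ _ => ?_]
  · refine Finset.sum_congr rfl fun σ _ => ?_
    rw [← (measurePreserving_signFlip σ).setIntegral_preimage_emb (measurableEmbedding_signFlip σ)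
      (fun y => g (signFlip σ y))]
    simp only [signFlip_signFlip]
  · exact ((measurePreserving_signFlip σ).integrable_comp_of_integrable hg).integrableOn

/-! ### The principal value -/

/-- The symmetrized integrand of the fractional Laplacian. -/
def symmIntegrand {d : ℕ} (α : ℝ) (u : E d → ℝ) (x ξ : E d) : ℝ :=
  signSum u x ξ / ‖ξ‖ ^ ((d : ℝ) + α)

lemma measurable_symmIntegrand {d : ℕ} (α : ℝ) {u : E d → ℝ} (hu : Continuous u) (x : E d) :
    Measurable (symmIntegrand α u x) :=
  (continuous_signSum hu x).measurable.div (measurable_norm.pow_const _)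

lemma abs_symmIntegrand_le {d : ℕ} (hd : 1 ≤ d) {α ε K : ℝ} (hα : 0 < α) (hε : 0 < ε) {u : E d → ℝ}
    (hu : HasSymmDiffBound (α + ε) K u) (x ξ : E d) :
    |symmIntegrand α u x ξ| ≤ 2 ^ d * K * ‖ξ‖ ^ (ε - (d : ℝ)) := by
  rcases eq_or_ne ξ 0 with rfl | hξ
  -- At the origin the integrand is zero, so only nonnegativity of the right side is needed; the
  -- sign of `K` is read off from the bound at a unit vector.
  · have hnn : 0 ≤ K := by
      have := nontrivial_E hd
      obtain ⟨e, he⟩ := exists_norm_eq (E d) zero_le_one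
      have h := (abs_nonneg _).trans (hu.abs_signSum_le (by linarith) x e)
      rw [he, Real.one_rpow, mul_one] at h
      exact nonneg_of_mul_nonneg_right h (by positivity)
    rw [symmIntegrand, signSum_zero, zero_div, abs_zero]
    positivity
  · have hξ' : 0 < ‖ξ‖ := norm_pos_iff.2 hξ
    rw [symmIntegrand, abs_div, abs_of_nonneg (Real.rpow_nonneg hξ'.le _)]
    calc |signSum u x ξ| / ‖ξ‖ ^ ((d : ℝ) + α)
        ≤ (2 ^ d * (K * ‖ξ‖ ^ (α + ε))) / ‖ξ‖ ^ ((d : ℝ) + α) := by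
          gcongr
          exact hu.abs_signSum_le (by linarith) x ξ
      _ = 2 ^ d * K * (‖ξ‖ ^ (α + ε) / ‖ξ‖ ^ ((d : ℝ) + α)) := by ring
      _ = _ := by
          rw [← Real.rpow_sub hξ']
          ring_nf

/-- Near the origin the order `α + ε` beats the singularity; at infinity boundedness of `u`
suffices. -/
lemma integrable_symmIntegrand {d : ℕ} (hd : 1 ≤ d) {α ε K M : ℝ} (hα : 0 < α) (hε : 0 < ε)
    {u : E d → ℝ} (hc : Continuous u) (hM : ∀ y, |u y| ≤ M)
    (hu : HasSymmDiffBound (α + ε) K u) (x : E d) : Integrable (symmIntegrand α u x) := by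
  have hmeas := (measurable_symmIntegrand α hc x).aestronglyMeasurable (μ := (volume : Measure (E d)))
  have h1 : IntegrableOn (symmIntegrand α u x) (Metric.ball 0 1) := by
    refine Integrable.mono' ((integrableOn_ball_norm_rpow hd hε one_pos).const_mul (2 ^ d * K))
      hmeas.restrict (ae_of_all _ fun ξ => ?_)
    exact abs_symmIntegrand_le hd hα hε hu x ξ
  have h2 : IntegrableOn (symmIntegrand α u x) {ξ : E d | 1 ≤ ‖ξ‖} := by
    refine Integrable.mono' ((integrableOn_norm_rpow_le hd hα one_pos).const_mul (2 ^ d * (2 * M)))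
      hmeas.restrict (ae_of_all _ fun ξ => ?_)
    rw [symmIntegrand, Real.norm_eq_abs, abs_div, abs_of_nonneg (Real.rpow_nonneg (norm_nonneg _) _),
      Real.rpow_neg (norm_nonneg _), ← div_eq_mul_inv]
    gcongr
    exact abs_signSum_le_of_bounded hM x ξ
  rw [← integrableOn_univ]
  refine (h1.union h2).mono_set fun ξ _ => ?_
  rcases lt_or_ge ‖ξ‖ 1 with h | h
  · exact Or.inl (by simpa using h)
  · exact Or.inr h

lemma integrableOn_fracIntegrand_translate {d : ℕ} (hd : 1 ≤ d) {α M : ℝ} (hα : 0 < α)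
    {u : E d → ℝ} (hc : Continuous u) (hM : ∀ y, |u y| ≤ M) (x : E d) {r : ℝ} (hr : 0 < r) :
    IntegrableOn (fun y => fracIntegrand α u x (x + y)) {y : E d | r < ‖y‖} := by
  refine Integrable.mono' (((integrableOn_norm_rpow_le hd hα hr).mono_set
    (fun y (hy : r < ‖y‖) => hy.le)).const_mul (2 * M)) ?_ (ae_of_all _ fun y => ?_)
  · refine Measurable.aestronglyMeasurable ?_
    simp only [fracIntegrand]
    exact (measurable_const.sub (hc.comp (continuous_const.add continuous_id)).measurable).div
      ((continuous_const.sub (continuous_const.add continuous_id)).norm.measurable.pow_const _)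
  · rw [fracIntegrand, Real.norm_eq_abs, abs_div, sub_add_cancel_left, norm_neg,
      abs_of_nonneg (Real.rpow_nonneg (norm_nonneg _) _), Real.rpow_neg (norm_nonneg _),
      ← div_eq_mul_inv]
    gcongr
    linarith [abs_sub (u x) (u (x + y)), hM x, hM (x + y)]

lemma preimage_translate {d : ℕ} (x : E d) (r : ℝ) :
    (fun y => x + y) ⁻¹' {x' : E d | r < ‖x - x'‖} = {y : E d | r < ‖y‖} := by
  ext y
  simp

lemma integrableOn_fracIntegrand {d : ℕ} (hd : 1 ≤ d) {α M : ℝ} (hα : 0 < α)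
    {u : E d → ℝ} (hc : Continuous u) (hM : ∀ y, |u y| ≤ M) (x : E d) {r : ℝ} (hr : 0 < r) :
    IntegrableOn (fracIntegrand α u x) {x' : E d | r < ‖x - x'‖} := by
  rw [← (measurePreserving_add_left volume x).integrableOn_comp_preimage
    (measurableEmbedding_addLeft x), preimage_translate]
  exact integrableOn_fracIntegrand_translate hd hα hc hM x hr

lemma measurableSet_lt_norm {d : ℕ} (r : ℝ) : MeasurableSet {y : E d | r < ‖y‖} :=
  measurableSet_lt measurable_const measurable_norm

/-- The truncation region is invariant under sign flips about `x`, so folding commutes with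
truncation. -/
lemma truncFracLaplacian_eq {d : ℕ} (hd : 1 ≤ d) {α M : ℝ} (hα : 0 < α)
    {u : E d → ℝ} (hc : Continuous u) (hM : ∀ y, |u y| ≤ M) (x : E d) {r : ℝ} (hr : 0 < r) :
    truncFracLaplacian α u x r = -fracConst d α *
      ∫ y in posOrthant d, {y : E d | r < ‖y‖}.indicator (symmIntegrand α u x) y := by
  have hint := integrableOn_fracIntegrand_translate hd hα hc hM x hr
  rw [truncFracLaplacian, ← (measurePreserving_add_left volume x).setIntegral_preimage_emb
    (measurableEmbedding_addLeft x), preimage_translate, ← integral_indicator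
    (measurableSet_lt_norm r), integral_eq_posOrthant
    ((integrable_indicator_iff (measurableSet_lt_norm r)).2 hint), neg_mul, ← mul_neg,
    ← integral_neg]
  congr 2
  ext y
  by_cases hy : r < ‖y‖
  · simp only [Set.indicator, Set.mem_ofPred_eq, LinearIsometryEquiv.norm_map, hy, if_true,
      fracIntegrand, sub_add_cancel_left, norm_neg, symmIntegrand, signSum_eq_sum]
    rw [← Finset.sum_div, ← neg_div, ← Finset.sum_neg_distrib]
    simp only [neg_sub]
  · simp [Set.indicator, hy]

lemma tendsto_truncFracLaplacian {d : ℕ} (hd : 1 ≤ d) {α ε K M : ℝ} (hα : 0 < α) (hε : 0 < ε)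
    {u : E d → ℝ} (hc : Continuous u) (hM : ∀ y, |u y| ≤ M)
    (hu : HasSymmDiffBound (α + ε) K u) (x : E d) :
    Tendsto (truncFracLaplacian α u x) (𝓝[>] 0)
      (𝓝 (-fracConst d α * ∫ y in posOrthant d, symmIntegrand α u x y)) := by
  have hG := integrable_symmIntegrand hd hα hε hc hM hu x
  have hlim : Tendsto (fun r : ℝ => ∫ y in posOrthant d,
      {y : E d | r < ‖y‖}.indicator (symmIntegrand α u x) y) (𝓝[>] 0)
      (𝓝 (∫ y in posOrthant d, symmIntegrand α u x y)) := by
    refine tendsto_integral_filter_of_dominated_convergence (fun y => ‖symmIntegrand α u x y‖)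
      (Eventually.of_forall fun r => ?_) (Eventually.of_forall fun r => ae_of_all _ fun y => ?_)
      hG.norm.integrableOn (ae_of_all _ fun y => ?_)
    · exact ((measurable_symmIntegrand α hc x).indicator
        (measurableSet_lt_norm r)).aestronglyMeasurable
    · exact norm_indicator_le_norm_self _ _
    · refine tendsto_const_nhds.congr' ?_
      rcases eq_or_ne y 0 with rfl | hy
      -- At `y = 0` the integrand itself vanishes, so the indicator is immaterial.
      · refine Eventually.of_forall fun r => ?_
        simp [Set.indicator, symmIntegrand, signSum_zero]
      · filter_upwards [mem_nhdsWithin_of_mem_nhds (Iio_mem_nhds (norm_pos_iff.2 hy))] with r hr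
        rw [Set.indicator_of_mem]
        exact hr
  refine (hlim.const_mul _).congr' ?_
  filter_upwards [self_mem_nhdsWithin] with r hr
  exact (truncFracLaplacian_eq hd hα hc hM x hr).symm

/-! ### Symmetric estimates away from the origin -/

/-- Away from the origin the ratio of norms stays in `[(1 + D)⁻¹, 1 + D]`, where the power is
Lipschitz at `1`. -/
lemma exists_abs_norm_div_rpow_sub_one_le {d : ℕ} {D : ℝ} (hD : 0 ≤ D) (b : ℝ) :
    ∃ C : ℝ, 0 ≤ C ∧ ∀ (h : ℝ) (c y : E d), 0 < h → h ≤ ‖c‖ → h ≤ ‖y‖ → ‖y - c‖ ≤ D * h →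
      |(‖y‖ / ‖c‖) ^ b - 1| ≤ C * (h / ‖c‖) := by
  obtain ⟨C, hC0, hC⟩ := exists_abs_rpow_sub_one_le b (κ := 1 + D) (by linarith)
  refine ⟨C * D, by positivity, fun h c y hh hc hy hyc => ?_⟩
  have hc0 : 0 < ‖c‖ := hh.trans_le hc
  have hy0 : 0 < ‖y‖ := hh.trans_le hy
  have h1 : |‖y‖ - ‖c‖| ≤ D * h := (abs_norm_sub_norm_le y c).trans hyc
  obtain ⟨h2, h3⟩ := abs_le.1 h1
  have hDc : D * h ≤ D * ‖c‖ := by gcongr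
  have hDy : D * h ≤ D * ‖y‖ := by gcongr
  have h4 : ‖y‖ / ‖c‖ ≤ 1 + D := by
    rw [div_le_iff₀ hc0]
    linarith
  have h5 : (1 + D)⁻¹ ≤ ‖y‖ / ‖c‖ := by
    rw [inv_eq_one_div, div_le_div_iff₀ (by linarith) hc0]
    linarith
  refine (hC _ h5 h4).trans ?_
  rw [mul_assoc]
  gcongr
  rw [div_sub_one hc0.ne', abs_div, abs_of_pos hc0, ← mul_div_assoc]
  gcongr

/-- The power is expanded in the squared ratio, with exponent `-γ / 2`, because the parallelogram
law evaluates the sum of the two linear terms exactly and shows it to be quadratic in `‖z‖ / ‖c‖`.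
The hypothesis `γ ≤ 2` puts `γ / 2` in the range of the Taylor estimate. -/
lemma exists_abs_norm_div_rpow_second_diff_le {d : ℕ} {D γ : ℝ} (hD : 0 ≤ D) (hγ0 : 0 ≤ γ)
    (hγ2 : γ ≤ 2) :
    ∃ C : ℝ, 0 ≤ C ∧ ∀ (h : ℝ) (c z : E d), 0 < h → h ≤ ‖c‖ → h ≤ ‖c + z‖ → h ≤ ‖c - z‖ →
      ‖z‖ ≤ D * h →
      |(‖c + z‖ / ‖c‖) ^ (-γ) + (‖c - z‖ / ‖c‖) ^ (-γ) - 2| ≤ C * (h / ‖c‖) ^ 2 := by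
  -- The first summand comes from the parallelogram term; the second is two Taylor remainders, with
  -- `κ = (1 + D) ^ 2` and `|r ^ 2 - 1| ≤ D * (2 + D) * (h / ‖c‖)`.
  refine ⟨2 * D ^ 2 + 2 * ((1 + D) ^ 2 * (D * (2 + D)) ^ 2), by positivity,
    fun h c z hh hc hp hm hz => ?_⟩
  have hc0 : 0 < ‖c‖ := hh.trans_le hc
  have key : ∀ y : E d, h ≤ ‖y‖ → ‖y - c‖ ≤ D * h →
      |(‖y‖ / ‖c‖) ^ (-γ) - (1 - γ / 2 * ((‖y‖ / ‖c‖) ^ 2 - 1))|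
        ≤ (1 + D) ^ 2 * ((D * (2 + D)) ^ 2 * (h / ‖c‖) ^ 2) := by
    intro y hy hyc
    have hy0 : 0 < ‖y‖ := hh.trans_le hy
    set r := ‖y‖ / ‖c‖ with hr
    have hr0 : 0 < r := by positivity
    have h1 : |‖y‖ - ‖c‖| ≤ D * h := (abs_norm_sub_norm_le y c).trans hyc
    obtain ⟨h2, h3⟩ := abs_le.1 h1
    have hDc : D * h ≤ D * ‖c‖ := by gcongr
    have hDy : D * h ≤ D * ‖y‖ := by gcongr
    have h4 : r ≤ 1 + D := by
      rw [hr, div_le_iff₀ hc0]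
      linarith
    have h5 : r⁻¹ ≤ 1 + D := by
      rw [hr, inv_div, div_le_iff₀ hy0]
      linarith
    have h6 : |r - 1| ≤ D * (h / ‖c‖) := by
      rw [hr, div_sub_one hc0.ne', abs_div, abs_of_pos hc0, ← mul_div_assoc]
      gcongr
    have h7 : (r ^ 2) ^ (-(γ / 2)) = r ^ (-γ) := by
      rw [← Real.rpow_natCast, ← Real.rpow_mul hr0.le]
      congr 1
      push_cast
      ring
    have h8 := abs_rpow_neg_sub_taylor_le (a := γ / 2) (by linarith) (by linarith)
      (t := r ^ 2) (κ := (1 + D) ^ 2) (by positivity) (by rw [← inv_pow]; gcongr)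
    rw [h7] at h8
    refine h8.trans ?_
    gcongr
    rw [← mul_pow, ← sq_abs]
    gcongr
    rw [show r ^ 2 - 1 = (r - 1) * (r + 1) by ring, abs_mul, abs_of_pos (by linarith : 0 < r + 1)]
    calc |r - 1| * (r + 1) ≤ D * (h / ‖c‖) * (2 + D) :=
          mul_le_mul h6 (by linarith) (by linarith) (by positivity)
      _ = _ := by ring
  have kp := abs_le.1 (key (c + z) hp (by simpa using hz))
  have km := abs_le.1 (key (c - z) hm (by simpa using hz))
  have hpar : (‖c + z‖ / ‖c‖) ^ 2 + (‖c - z‖ / ‖c‖) ^ 2 - 2 = 2 * (‖z‖ / ‖c‖) ^ 2 := by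
    have := parallelogram_law_with_norm ℝ c z
    field_simp
    linarith
  have hz2 : (‖z‖ / ‖c‖) ^ 2 ≤ D ^ 2 * (h / ‖c‖) ^ 2 := by
    rw [← mul_pow, ← mul_div_assoc]
    gcongr
  have hz0 : 0 ≤ (‖z‖ / ‖c‖) ^ 2 := by positivity
  have hlin : γ / 2 * ((‖c + z‖ / ‖c‖) ^ 2 - 1) + γ / 2 * ((‖c - z‖ / ‖c‖) ^ 2 - 1)
      = γ * (‖z‖ / ‖c‖) ^ 2 := by
    rw [← mul_add]
    linear_combination γ / 2 * hpar
  have hb0 : 0 ≤ γ * (‖z‖ / ‖c‖) ^ 2 := by positivity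
  have hb1 : γ * (‖z‖ / ‖c‖) ^ 2 ≤ 2 * (D ^ 2 * (h / ‖c‖) ^ 2) := by gcongr
  rw [abs_le]
  constructor <;> linarith [kp.1, kp.2, km.1, km.2]

/-- Discrete Leibniz rule: each difference of `S` meets the power of `q` supplied by its partner
difference of `P`, so all products have the same size `A`. -/
lemma abs_mul_second_diff_le {S₀ S₁ S₂ P₁ P₂ q C A : ℝ} (hC : 0 ≤ C)
    (h0 : |S₀| * q ^ 2 ≤ A) (h1 : |S₁ - S₀| * q ≤ A) (h2 : |S₂ - S₀| * q ≤ A)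
    (h12 : |S₁ + S₂ - 2 * S₀| ≤ A) (hP1 : |P₁ - 1| ≤ C * q) (hP2 : |P₂ - 1| ≤ C * q)
    (hP12 : |P₁ + P₂ - 2| ≤ C * q ^ 2) :
    |S₁ * P₁ + S₂ * P₂ - 2 * S₀| ≤ (1 + 3 * C) * A := by
  have e : S₁ * P₁ + S₂ * P₂ - 2 * S₀ = (S₁ + S₂ - 2 * S₀) + S₀ * (P₁ + P₂ - 2)
      + (S₁ - S₀) * (P₁ - 1) + (S₂ - S₀) * (P₂ - 1) := by ring
  have t0 : |S₀ * (P₁ + P₂ - 2)| ≤ C * A := by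
    rw [abs_mul]
    calc |S₀| * |P₁ + P₂ - 2| ≤ |S₀| * (C * q ^ 2) := by gcongr
      _ = C * (|S₀| * q ^ 2) := by ring
      _ ≤ _ := by gcongr
  have t1 : |(S₁ - S₀) * (P₁ - 1)| ≤ C * A := by
    rw [abs_mul]
    calc |S₁ - S₀| * |P₁ - 1| ≤ |S₁ - S₀| * (C * q) := by gcongr
      _ = C * (|S₁ - S₀| * q) := by ring
      _ ≤ _ := by gcongr
  have t2 : |(S₂ - S₀) * (P₂ - 1)| ≤ C * A := by
    rw [abs_mul]
    calc |S₂ - S₀| * |P₂ - 1| ≤ |S₂ - S₀| * (C * q) := by gcongr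
      _ = C * (|S₂ - S₀| * q) := by ring
      _ ≤ _ := by gcongr
  rw [e]
  refine (abs_add_le _ _).trans ?_
  have := abs_add_three (S₁ + S₂ - 2 * S₀) (S₀ * (P₁ + P₂ - 2)) ((S₁ - S₀) * (P₁ - 1))
  linarith

lemma abs_mul_first_diff_le {S₀ S₁ P₁ q C A : ℝ} (hC : 0 ≤ C) (hq0 : 0 ≤ q) (hq1 : q ≤ 1)
    (h0 : |S₀| * q ^ 2 ≤ A) (h1 : |S₁ - S₀| * q ≤ A) (hP1 : |P₁ - 1| ≤ C * q) :
    |S₁ * P₁ - S₀| * q ≤ (1 + 2 * C) * A := by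
  have e : S₁ * P₁ - S₀ = (S₁ - S₀) * P₁ + S₀ * (P₁ - 1) := by ring
  have hP : |P₁| ≤ 1 + C := by
    have h3 := abs_sub_abs_le_abs_sub P₁ 1
    rw [abs_one] at h3
    nlinarith
  have hA : 0 ≤ A := (by positivity : 0 ≤ |S₁ - S₀| * q).trans h1
  have t1 : |(S₁ - S₀) * P₁| * q ≤ (1 + C) * A := by
    rw [abs_mul]
    calc |S₁ - S₀| * |P₁| * q = |S₁ - S₀| * q * |P₁| := by ring
      _ ≤ A * (1 + C) := by gcongr
      _ = _ := by ring
  have t2 : |S₀ * (P₁ - 1)| * q ≤ C * A := by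
    rw [abs_mul]
    calc |S₀| * |P₁ - 1| * q ≤ |S₀| * (C * q) * q := by gcongr
      _ = C * (|S₀| * q ^ 2) := by ring
      _ ≤ _ := by gcongr
  rw [e]
  calc _ ≤ (|(S₁ - S₀) * P₁| + |S₀ * (P₁ - 1)|) * q := by
        gcongr
        exact abs_add_le _ _
    _ ≤ _ := by linarith

lemma psi_eq_mul {d : ℕ} (γ : ℝ) (u : E d → ℝ) (x : E d) {c y : E d} (hc : 0 < ‖c‖) :
    psi γ u x y = signSum u x y * (‖y‖ / ‖c‖) ^ (-γ) * ‖c‖ ^ (-γ) := by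
  rw [psi_eq_signSum_div, mul_assoc, ← Real.mul_rpow (by positivity) hc.le,
    div_mul_cancel₀ _ hc.ne', Real.rpow_neg (norm_nonneg _), div_eq_mul_inv]

/-- With `q = h / ‖c‖`, the value, first difference and second difference of `signSum`, multiplied
by `q ^ 2`, `q` and `1`, are all `O(h ^ s)`. The Leibniz estimates then handle the factor `‖ξ‖ ^
(-γ)`. The first-difference bound is kept because the weight `ω_γ` is not symmetric about `c`. -/
lemma exists_psi_diff_bounds {d : ℕ} {D γ s : ℝ} (hD : 0 < D) (hγ0 : 0 ≤ γ) (hγ2 : γ ≤ 2)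
    (hs0 : 0 < s) (hs2 : s ≤ 2) {u : E d → ℝ} {K : ℝ} (hK : 0 ≤ K) (hu : HasSymmDiffBound s K u) :
    ∃ C : ℝ, 0 ≤ C ∧ ∀ (h : ℝ) (x c z : E d), 0 < h → h ≤ ‖c‖ → h ≤ ‖c + z‖ → h ≤ ‖c - z‖ →
      ‖z‖ ≤ D * h →
      |psi γ u x (c + z) + psi γ u x (c - z) - 2 * psi γ u x c| ≤ C * h ^ s * ‖c‖ ^ (-γ) ∧
      |psi γ u x (c - z) - psi γ u x c| * (h / ‖c‖) ≤ C * h ^ s * ‖c‖ ^ (-γ) := by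
  obtain ⟨C₁, hC₁0, hC₁⟩ := exists_abs_norm_div_rpow_sub_one_le (d := d) hD.le (-γ)
  obtain ⟨C₂, hC₂0, hC₂⟩ := exists_abs_norm_div_rpow_second_diff_le (d := d) hD.le hγ0 hγ2
  -- The three summands serve, in order, the value, the second difference and the first difference
  -- of `signSum`.
  set A := 2 ^ d * K * (1 + D ^ s + D ^ (s - 1) * (1 + D)) with hA
  have hDs : 0 ≤ D ^ s := by positivity
  have hDs1 : 0 ≤ D ^ (s - 1) * (1 + D) := by positivity
  have hA0 : 0 ≤ A := by positivity
  refine ⟨(1 + 3 * (C₁ + C₂)) * A, by positivity, fun h x c z hh hc hp hm hz => ?_⟩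
  have hc0 : 0 < ‖c‖ := hh.trans_le hc
  have hhs : 0 < h ^ s := by positivity
  set q := h / ‖c‖ with hq
  have hq0 : 0 < q := by positivity
  have hq1 : q ≤ 1 := (div_le_one hc0).2 hc
  have b0 : |signSum u x c| * q ^ 2 ≤ A * h ^ s := by
    have h1 : ‖c‖ ^ s * q ^ 2 ≤ h ^ s := by
      have h2 : (‖c‖ / h) ^ s ≤ (‖c‖ / h) ^ (2 : ℝ) :=
        Real.rpow_le_rpow_of_exponent_le ((one_le_div hh).2 hc) hs2
      rw [Real.div_rpow hc0.le hh.le, Real.rpow_two, div_le_iff₀ hhs] at h2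
      calc ‖c‖ ^ s * q ^ 2 ≤ (‖c‖ / h) ^ 2 * h ^ s * q ^ 2 := by gcongr
        _ = h ^ s := by rw [hq]; field_simp
    calc |signSum u x c| * q ^ 2 ≤ 2 ^ d * (K * ‖c‖ ^ s) * q ^ 2 := by
          gcongr
          exact hu.abs_signSum_le hs0 x c
      _ = 2 ^ d * K * (‖c‖ ^ s * q ^ 2) := by ring
      _ ≤ 2 ^ d * K * h ^ s := by gcongr
      _ ≤ A * h ^ s := by
          gcongr
          rw [hA]
          exact le_mul_of_one_le_right (by positivity) (by linarith)
  have b1 : ∀ w : E d, ‖w‖ ≤ D * h → |signSum u x (c + w) - signSum u x c| * q ≤ A * h ^ s := by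
    intro w hw
    have hDh : 0 < D * h := by positivity
    have h1 : (D * h) ^ (s - 1) * (‖c‖ + D * h) * q ≤ D ^ (s - 1) * (1 + D) * h ^ s := by
      rw [Real.mul_rpow hD.le hh.le, ← rpow_sub_one_mul hh s]
      have h2 : (‖c‖ + D * h) * q ≤ (1 + D) * h := by
        rw [hq, ← mul_div_assoc, div_le_iff₀ hc0]
        have : D * h ≤ D * ‖c‖ := by gcongr
        nlinarith
      calc D ^ (s - 1) * h ^ (s - 1) * (‖c‖ + D * h) * q
          = D ^ (s - 1) * h ^ (s - 1) * ((‖c‖ + D * h) * q) := by ring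
        _ ≤ D ^ (s - 1) * h ^ (s - 1) * ((1 + D) * h) := by gcongr
        _ = _ := by ring
    calc |signSum u x (c + w) - signSum u x c| * q
        ≤ 2 ^ d * (K * ((D * h) ^ (s - 1) * (‖c‖ + D * h))) * q := by
          gcongr
          exact hu.abs_signSum_add_sub_le x c w hDh hw
      _ = 2 ^ d * K * ((D * h) ^ (s - 1) * (‖c‖ + D * h) * q) := by ring
      _ ≤ 2 ^ d * K * (D ^ (s - 1) * (1 + D) * h ^ s) := by gcongr
      _ = 2 ^ d * K * (D ^ (s - 1) * (1 + D)) * h ^ s := by ring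
      _ ≤ A * h ^ s := by
          rw [hA]
          gcongr
          linarith
  have b2 : |signSum u x (c + z) + signSum u x (c - z) - 2 * signSum u x c| ≤ A * h ^ s := by
    have hDh : 0 < D * h := by positivity
    refine (hu.abs_signSum_second_diff_le x c z hDh hz).trans ?_
    rw [Real.mul_rpow hD.le hh.le]
    calc 2 ^ d * (K * (D ^ s * h ^ s)) = 2 ^ d * K * D ^ s * h ^ s := by ring
      _ ≤ A * h ^ s := by
          rw [hA]
          gcongr
          linarith
  have b1m : |signSum u x (c - z) - signSum u x c| * q ≤ A * h ^ s := by
    have := b1 (-z) (by simpa using hz)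
    rwa [← sub_eq_add_neg] at this
  have p1 := hC₁ h c (c + z) hh hc hp (by simpa using hz)
  have p2 := hC₁ h c (c - z) hh hc hm (by simpa using hz)
  have p12 := hC₂ h c z hh hc hp hm hz
  have hC12 : 0 ≤ C₁ + C₂ := by positivity
  have p1' : |(‖c + z‖ / ‖c‖) ^ (-γ) - 1| ≤ (C₁ + C₂) * q :=
    p1.trans (mul_le_mul_of_nonneg_right (by linarith) hq0.le)
  have p2' : |(‖c - z‖ / ‖c‖) ^ (-γ) - 1| ≤ (C₁ + C₂) * q :=
    p2.trans (mul_le_mul_of_nonneg_right (by linarith) hq0.le)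
  have p12' : |(‖c + z‖ / ‖c‖) ^ (-γ) + (‖c - z‖ / ‖c‖) ^ (-γ) - 2| ≤ (C₁ + C₂) * q ^ 2 :=
    p12.trans (mul_le_mul_of_nonneg_right (by linarith) (by positivity))
  have f12 := abs_mul_second_diff_le hC12 b0 (b1 z hz) b1m b2 p1' p2' p12'
  have f1 := abs_mul_first_diff_le hC12 hq0.le hq1 b0 b1m p2'
  have hcg : 0 ≤ ‖c‖ ^ (-γ) := by positivity
  have e0 : psi γ u x c = signSum u x c * ‖c‖ ^ (-γ) := by
    rw [psi_eq_mul γ u x hc0, div_self hc0.ne', Real.one_rpow, mul_one]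
  rw [psi_eq_mul γ u x (y := c + z) hc0, psi_eq_mul γ u x (y := c - z) hc0, e0]
  constructor
  · rw [← add_mul, ← mul_assoc, ← sub_mul, abs_mul, abs_of_nonneg hcg]
    refine mul_le_mul_of_nonneg_right (f12.trans (le_of_eq ?_)) hcg
    ring
  · rw [← sub_mul, abs_mul, abs_of_nonneg hcg, mul_right_comm]
    refine mul_le_mul_of_nonneg_right (f1.trans ?_) hcg
    rw [← mul_assoc]
    gcongr
    linarith

/-- The symmetrized quadrature error density at the pair `c ± z`. -/
lemma exists_error_density_bounds {d : ℕ} {α D γ s : ℝ} (hD : 0 < D) (hγ0 : 0 ≤ γ) (hγ2 : γ ≤ 2)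
    (hs0 : 0 < s) (hs2 : s ≤ 2) {u : E d → ℝ} {K : ℝ} (hK : 0 ≤ K) (hu : HasSymmDiffBound s K u) :
    ∃ C : ℝ, 0 ≤ C ∧ ∀ (h : ℝ) (x c z : E d), 0 < h → h ≤ ‖c‖ → h ≤ ‖c + z‖ → h ≤ ‖c - z‖ →
      ‖z‖ ≤ D * h →
      |(psi γ u x (c + z) - psi γ u x c) * ‖c + z‖ ^ (γ - ((d : ℝ) + α))
        + (psi γ u x (c - z) - psi γ u x c) * ‖c - z‖ ^ (γ - ((d : ℝ) + α))|
        ≤ C * h ^ s * ‖c + z‖ ^ (-((d : ℝ) + α)) := by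
  obtain ⟨C₁, hC₁0, hC₁⟩ := exists_psi_diff_bounds hD hγ0 hγ2 hs0 hs2 hK hu
  set b := γ - ((d : ℝ) + α) with hb
  obtain ⟨C₂, hC₂0, hC₂⟩ := exists_abs_norm_div_rpow_sub_one_le (d := d) hD.le b
  obtain ⟨C₃, hC₃0, hC₃⟩ := exists_abs_norm_div_rpow_sub_one_le (d := d) hD.le (-((d : ℝ) + α))
  refine ⟨(1 + 3 * C₂) * C₁ * (1 + C₃), by positivity, fun h x c z hh hc hp hm hz => ?_⟩
  have hc0 : 0 < ‖c‖ := hh.trans_le hc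
  have hp0 : 0 < ‖c + z‖ := hh.trans_le hp
  obtain ⟨f12, f1⟩ := hC₁ h x c z hh hc hp hm hz
  set q := h / ‖c‖ with hq
  have hq0 : 0 < q := by positivity
  have hq1 : q ≤ 1 := (div_le_one hc0).2 hc
  set f₀ := psi γ u x c
  set f₁ := psi γ u x (c + z)
  set f₂ := psi γ u x (c - z)
  set R₁ := (‖c + z‖ / ‖c‖) ^ b with hR₁
  set R₂ := (‖c - z‖ / ‖c‖) ^ b with hR₂
  set B := C₁ * h ^ s * ‖c‖ ^ (-γ) with hB
  have hB0 : 0 ≤ B := by positivity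
  have r1 : |R₁ - 1| ≤ C₂ * q := hC₂ h c (c + z) hh hc hp (by simpa using hz)
  have r2 : |R₂ - 1| ≤ C₂ * q := hC₂ h c (c - z) hh hc hm (by simpa using hz)
  have r1' : |R₁| ≤ 1 + C₂ := by
    have h3 := abs_sub_abs_le_abs_sub R₁ 1
    rw [abs_one] at h3
    nlinarith
  have r21 : |R₂ - R₁| ≤ 2 * C₂ * q := by
    have := abs_sub_le R₂ 1 R₁
    rw [abs_sub_comm 1 R₁] at this
    linarith
  have w1 : ‖c + z‖ ^ b = R₁ * ‖c‖ ^ b := by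
    rw [hR₁, ← Real.mul_rpow (by positivity) hc0.le, div_mul_cancel₀ _ hc0.ne']
  have w2 : ‖c - z‖ ^ b = R₂ * ‖c‖ ^ b := by
    rw [hR₂, ← Real.mul_rpow (by positivity) hc0.le, div_mul_cancel₀ _ hc0.ne']
  have hmain : |(f₁ - f₀) * R₁ + (f₂ - f₀) * R₂| ≤ (1 + 3 * C₂) * B := by
    -- The asymmetry `R₂ - R₁` of the weight is `O(q)` and is absorbed by the first-difference
    -- bound.
    have e : (f₁ - f₀) * R₁ + (f₂ - f₀) * R₂
        = (f₁ + f₂ - 2 * f₀) * R₁ + (f₂ - f₀) * (R₂ - R₁) := by ring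
    have t1 : |(f₁ + f₂ - 2 * f₀) * R₁| ≤ B * (1 + C₂) := by
      rw [abs_mul]
      gcongr
    have t2 : |(f₂ - f₀) * (R₂ - R₁)| ≤ 2 * C₂ * B := by
      rw [abs_mul]
      calc |f₂ - f₀| * |R₂ - R₁| ≤ |f₂ - f₀| * (2 * C₂ * q) := by gcongr
        _ = 2 * C₂ * (|f₂ - f₀| * q) := by ring
        _ ≤ _ := by gcongr
    rw [e]
    exact (abs_add_le _ _).trans (by linarith)
  have hcb : 0 ≤ ‖c‖ ^ b := by positivity
  -- Powers of `‖c‖` are traded for powers of `‖c + z‖`, so that the bound can be integrated over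
  -- the cell.
  have hcc : ‖c‖ ^ (-γ) * ‖c‖ ^ b ≤ (1 + C₃) * ‖c + z‖ ^ (-((d : ℝ) + α)) := by
    have h1 := hC₃ h (c + z) c hh hp hc (by simpa using hz)
    have h2 : h / ‖c + z‖ ≤ 1 := (div_le_one hp0).2 hp
    have h3 : (‖c‖ / ‖c + z‖) ^ (-((d : ℝ) + α)) ≤ 1 + C₃ := by
      have := (abs_le.1 h1).2
      nlinarith
    rw [← Real.rpow_add hc0, show -γ + b = -((d : ℝ) + α) by rw [hb]; ring]
    calc ‖c‖ ^ (-((d : ℝ) + α))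
        = (‖c‖ / ‖c + z‖) ^ (-((d : ℝ) + α)) * ‖c + z‖ ^ (-((d : ℝ) + α)) := by
          rw [← Real.mul_rpow (by positivity) hp0.le, div_mul_cancel₀ _ hp0.ne']
      _ ≤ _ := by gcongr
  rw [w1, w2, ← mul_assoc, ← mul_assoc, ← add_mul, abs_mul, abs_of_nonneg hcb]
  calc _ ≤ (1 + 3 * C₂) * B * ‖c‖ ^ b := by gcongr
    _ = (1 + 3 * C₂) * C₁ * h ^ s * (‖c‖ ^ (-γ) * ‖c‖ ^ b) := by rw [hB]; ring
    _ ≤ (1 + 3 * C₂) * C₁ * h ^ s * ((1 + C₃) * ‖c + z‖ ^ (-((d : ℝ) + α))) := by gcongr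
    _ = _ := by ring

/-! ### The quadrature error on a single cell -/

lemma norm_le_of_coord_le {d : ℕ} {ξ : E d} {t : ℝ} (ht : 0 ≤ t) (h : ∀ j, |ξ j| ≤ t) :
    ‖ξ‖ ≤ d * t := by
  rw [EuclideanSpace.norm_eq]
  refine Real.sqrt_le_iff.2 ⟨by positivity, ?_⟩
  calc ∑ j, ‖ξ j‖ ^ 2 ≤ ∑ _j : Fin d, t ^ 2 := Finset.sum_le_sum fun j _ => by
        rw [Real.norm_eq_abs]
        gcongr
        exact h j
    _ = d * t ^ 2 := by simp
    _ ≤ (d * t) ^ 2 := by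
        rw [mul_pow]
        gcongr
        exact_mod_cast Nat.le_self_pow two_ne_zero d

lemma le_norm_of_coord_le {d : ℕ} {ξ : E d} {t : ℝ} (j : Fin d) (h : t ≤ ξ j) : t ≤ ‖ξ‖ :=
  (h.trans (le_abs_self _)).trans (PiLp.norm_apply_le ξ j)

lemma measurableSet_cell {d : ℕ} (h : ℝ) (i : Fin d → ℕ) : MeasurableSet (cell h i : Set (E d)) := by
  have : (cell h i : Set (E d))
      = ⋂ j, {ξ : E d | (i j : ℝ) * h ≤ ξ j} ∩ {ξ : E d | ξ j ≤ ((i j : ℝ) + 1) * h} := by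
    ext
    simp [cell]
  rw [this]
  exact MeasurableSet.iInter fun j => (measurableSet_le measurable_const (measurable_coord j)).inter
    (measurableSet_le (measurable_coord j) measurable_const)

lemma norm_le_of_mem_cell {d n : ℕ} {h : ℝ} (hh : 0 < h) {i : Fin d → ℕ} (hi : ∀ j, i j < n)
    {ξ : E d} (hξ : ξ ∈ cell h i) : ‖ξ‖ ≤ d * (n * h) := by
  refine norm_le_of_coord_le (by positivity) fun j => ?_
  have h1 : ((i j : ℝ) + 1) ≤ n := by exact_mod_cast hi j
  obtain ⟨h2, h3⟩ := hξ j
  have h4 : 0 ≤ (i j : ℝ) * h := by positivity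
  rw [abs_of_nonneg (h4.trans h2)]
  exact h3.trans (by gcongr)

lemma cell_subset_ball {d n : ℕ} {h : ℝ} (hh : 0 < h) {i : Fin d → ℕ} (hi : ∀ j, i j < n) :
    (cell h i : Set (E d)) ⊆ Metric.ball 0 (d * (n * h) + h) := fun ξ hξ => by
  have := norm_le_of_mem_cell hh hi hξ
  simp only [Metric.mem_ball, dist_zero_right]
  linarith

lemma exists_lt_of_multiIdx {d : ℕ} (i : Fin d → ℕ) : ∃ n : ℕ, ∀ j, i j < n :=
  ⟨∑ j, i j + 1, fun j => Nat.lt_succ_of_le (Finset.single_le_sum (fun _ _ => Nat.zero_le _)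
    (Finset.mem_univ j))⟩

lemma le_norm_of_mem_cell {d : ℕ} {h : ℝ} (hh : 0 < h) {i : Fin d → ℕ} (hi : i ≠ 0)
    {ξ : E d} (hξ : ξ ∈ cell h i) : h ≤ ‖ξ‖ := by
  obtain ⟨j, hj⟩ := Function.ne_iff.1 hi
  refine le_norm_of_coord_le j (le_trans ?_ (hξ j).1)
  have h1 : (1 : ℝ) ≤ i j := by exact_mod_cast Nat.one_le_iff_ne_zero.2 hj
  nlinarith

/-- The condition `α < γ` matters only on the cell at the origin, where the exponent is `(γ - α) -
d`. -/
lemma integrableOn_cell_weight {d : ℕ} (hd : 1 ≤ d) {α γ : ℝ} (hγ : α < γ) {h : ℝ} (hh : 0 < h)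
    (i : Fin d → ℕ) :
    IntegrableOn (fun ξ : E d => ‖ξ‖ ^ (γ - ((d : ℝ) + α))) (cell h i) := by
  obtain ⟨n, hn⟩ := exists_lt_of_multiIdx i
  have h1 : γ - ((d : ℝ) + α) = (γ - α) - d := by ring
  rw [h1]
  exact (integrableOn_ball_norm_rpow hd (sub_pos.2 hγ) (by positivity)).mono_set
    (cell_subset_ball hh hn)

/-- The midpoint of the cell `I_i`. -/
def cellCenter {d : ℕ} (h : ℝ) (i : Fin d → ℕ) : E d :=
  WithLp.toLp 2 fun j => ((i j : ℝ) + 1 / 2) * h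

lemma cellCenter_mem {d : ℕ} {h : ℝ} (hh : 0 < h) (i : Fin d → ℕ) : cellCenter h i ∈ cell h i := by
  intro j
  simp only [cellCenter]
  constructor <;> nlinarith

lemma reflect_mem_cell {d : ℕ} {h : ℝ} {i : Fin d → ℕ} {ξ : E d} (hξ : ξ ∈ cell h i) :
    cellCenter h i + cellCenter h i - ξ ∈ cell h i := by
  intro j
  obtain ⟨h1, h2⟩ := hξ j
  simp only [cellCenter, PiLp.sub_apply, PiLp.add_apply]
  constructor <;> linarith

lemma preimage_reflect_cell {d : ℕ} (h : ℝ) (i : Fin d → ℕ) :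
    (fun ξ => cellCenter h i + cellCenter h i - ξ) ⁻¹' cell h i = cell h i := by
  ext ξ
  refine ⟨fun hξ => ?_, fun hξ => reflect_mem_cell hξ⟩
  have := reflect_mem_cell (Set.mem_preimage.1 hξ)
  rwa [sub_sub_cancel] at this

lemma gridPt_add_mem_cell {d : ℕ} {h : ℝ} (hh : 0 < h) (i : Fin d → ℕ) {m : Fin d → ℕ}
    (hm : m ∈ multiIdx d 2) : gridPt h (i + m) ∈ cell h i := by
  intro j
  have h1 : (m j : ℝ) ≤ 1 := by exact_mod_cast Nat.le_of_lt_succ (mem_multiIdx.1 hm j)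
  have h2 : (0 : ℝ) ≤ m j := by positivity
  simp only [gridPt, Pi.add_apply, Nat.cast_add]
  constructor <;> (gcongr; try linarith)

lemma gridPt_add_reflect {d : ℕ} (h : ℝ) (i : Fin d → ℕ) {m : Fin d → ℕ}
    (hm : m ∈ multiIdx d 2) :
    gridPt h (i + fun j => 1 - m j)
      = cellCenter h i + cellCenter h i - (gridPt h (i + m) : E d) := by
  ext j
  have h1 : m j ≤ 1 := Nat.le_of_lt_succ (mem_multiIdx.1 hm j)
  simp only [gridPt, cellCenter, Pi.add_apply, Nat.cast_add, PiLp.sub_apply, PiLp.add_apply,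
    Nat.cast_sub h1]
  push_cast
  ring

lemma norm_sub_cellCenter_le {d : ℕ} {h : ℝ} (hh : 0 < h) {i : Fin d → ℕ} {ξ : E d}
    (hξ : ξ ∈ cell h i) : ‖ξ - cellCenter h i‖ ≤ d * h := by
  refine norm_le_of_coord_le hh.le fun j => ?_
  obtain ⟨h1, h2⟩ := hξ j
  simp only [cellCenter, PiLp.sub_apply]
  rw [abs_le]
  constructor <;> linarith

lemma symmIntegrand_eq_psi_mul {d : ℕ} (α γ : ℝ) (u : E d → ℝ) (x : E d) {ξ : E d} (hξ : 0 < ‖ξ‖) :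
    symmIntegrand α u x ξ = psi γ u x ξ * ‖ξ‖ ^ (γ - ((d : ℝ) + α)) := by
  rw [symmIntegrand, psi_eq_signSum_div, Real.rpow_sub hξ]
  have : 0 < ‖ξ‖ ^ γ := by positivity
  field_simp

lemma measurePreserving_reflect {d : ℕ} (c : E d) :
    MeasurePreserving (fun ξ : E d => c + c - ξ) :=
  Measure.measurePreserving_sub_left volume (c + c)

lemma measurableEmbedding_reflect {d : ℕ} (c : E d) :
    MeasurableEmbedding (fun ξ : E d => c + c - ξ) :=
  (Homeomorph.subLeft (c + c)).measurableEmbedding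

lemma integrableOn_cell_reflect {d : ℕ} {h : ℝ} {i : Fin d → ℕ} {g : E d → ℝ}
    (hg : IntegrableOn g (cell h i)) :
    IntegrableOn (fun ξ => g (cellCenter h i + cellCenter h i - ξ)) (cell h i) := by
  have := ((measurePreserving_reflect (cellCenter h i)).integrableOn_comp_preimage
    (measurableEmbedding_reflect _)).2 hg
  rwa [preimage_reflect_cell] at this

lemma integral_cell_reflect {d : ℕ} (h : ℝ) (i : Fin d → ℕ) (g : E d → ℝ) :
    ∫ ξ in cell h i, g (cellCenter h i + cellCenter h i - ξ) = ∫ ξ in cell h i, g ξ := by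
  have := (measurePreserving_reflect (cellCenter h i)).setIntegral_preimage_emb
    (measurableEmbedding_reflect _) g (cell h i)
  rwa [preimage_reflect_cell] at this

lemma integrableOn_cell_norm_rpow {d : ℕ} (hd : 1 ≤ d) {α : ℝ} (hα : 0 < α) {h : ℝ} (hh : 0 < h)
    {i : Fin d → ℕ} (hi : i ≠ 0) :
    IntegrableOn (fun ξ : E d => ‖ξ‖ ^ (-((d : ℝ) + α))) (cell h i) :=
  (integrableOn_norm_rpow_le hd hα hh).mono_set fun _ hξ => le_norm_of_mem_cell hh hi hξ

/-- Norms within a cell off the origin are comparable, so freezing `‖ξ‖ ^ (-γ)` at the centre costs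
a constant. -/
lemma exists_center_rpow_mul_weight_le {d : ℕ} (hd : 1 ≤ d) {α γ : ℝ} (hα : 0 < α) (hγα : α < γ) :
    ∃ C : ℝ, 0 ≤ C ∧ ∀ (h : ℝ) (i : Fin d → ℕ), 0 < h → i ≠ 0 →
      ‖(cellCenter h i : E d)‖ ^ (-γ) * (∫ ξ in cell h i, ‖ξ‖ ^ (γ - ((d : ℝ) + α)))
        ≤ C * ∫ ξ in cell h i, ‖ξ‖ ^ (-((d : ℝ) + α)) := by
  obtain ⟨C, hC0, hC⟩ := exists_abs_norm_div_rpow_sub_one_le (d := d) (Nat.cast_nonneg d) (-γ)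
  refine ⟨1 + C, by positivity, fun h i hh hi => ?_⟩
  rw [← integral_const_mul, ← integral_const_mul]
  refine setIntegral_mono_on ((integrableOn_cell_weight hd hγα hh i).const_mul _)
    ((integrableOn_cell_norm_rpow hd hα hh hi).const_mul _) (measurableSet_cell h i) fun ξ hξ => ?_
  have hξn := le_norm_of_mem_cell hh hi hξ
  have hξ0 : 0 < ‖ξ‖ := hh.trans_le hξn
  set c := (cellCenter h i : E d) with hc
  have h1 := hC h ξ c hh hξn (le_norm_of_mem_cell hh hi (cellCenter_mem hh i))
    (by rw [norm_sub_rev]; exact norm_sub_cellCenter_le hh hξ)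
  have h2 : h / ‖ξ‖ ≤ 1 := (div_le_one hξ0).2 hξn
  have h3 : (‖c‖ / ‖ξ‖) ^ (-γ) ≤ 1 + C := by
    have := (abs_le.1 h1).2
    nlinarith
  calc ‖c‖ ^ (-γ) * ‖ξ‖ ^ (γ - ((d : ℝ) + α))
      = (‖c‖ / ‖ξ‖) ^ (-γ) * (‖ξ‖ ^ (-γ) * ‖ξ‖ ^ (γ - ((d : ℝ) + α))) := by
        rw [← mul_assoc, ← Real.mul_rpow (by positivity) hξ0.le, div_mul_cancel₀ _ hξ0.ne']
    _ = (‖c‖ / ‖ξ‖) ^ (-γ) * ‖ξ‖ ^ (-((d : ℝ) + α)) := by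
        rw [← Real.rpow_add hξ0]
        ring_nf
    _ ≤ _ := by gcongr

lemma pair_mem_cell {d : ℕ} {h : ℝ} (hh : 0 < h) {i : Fin d → ℕ} (hi : i ≠ 0) {ξ : E d}
    (hξ : ξ ∈ cell h i) :
    cellCenter h i + (ξ - cellCenter h i) = ξ ∧
      cellCenter h i - (ξ - cellCenter h i) = cellCenter h i + cellCenter h i - ξ ∧
      h ≤ ‖cellCenter h i + (ξ - cellCenter h i)‖ ∧
      h ≤ ‖cellCenter h i - (ξ - cellCenter h i)‖ ∧ ‖ξ - cellCenter h i‖ ≤ d * h := by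
  have e1 : cellCenter h i + (ξ - cellCenter h i) = ξ := by abel
  have e2 : cellCenter h i - (ξ - cellCenter h i) = cellCenter h i + cellCenter h i - ξ := by abel
  refine ⟨e1, e2, ?_, ?_, norm_sub_cellCenter_le hh hξ⟩
  · rw [e1]
    exact le_norm_of_mem_cell hh hi hξ
  · rw [e2]
    exact le_norm_of_mem_cell hh hi (reflect_mem_cell hξ)

/-- Pairing each vertex with the opposite one writes twice the error as a sum of second differences
about the centre. -/
lemma exists_vertex_sum_bound {d : ℕ} (hd : 1 ≤ d) {γ s : ℝ} (hγ0 : 0 ≤ γ)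
    (hγ2 : γ ≤ 2) (hs0 : 0 < s) (hs2 : s ≤ 2) {u : E d → ℝ} {K : ℝ} (hK : 0 ≤ K)
    (hu : HasSymmDiffBound s K u) :
    ∃ C : ℝ, 0 ≤ C ∧ ∀ (h : ℝ) (x : E d) (i : Fin d → ℕ), 0 < h → i ≠ 0 →
      |(∑ m ∈ multiIdx d 2, psi γ u x (gridPt h (i + m))) - 2 ^ d * psi γ u x (cellCenter h i)|
        ≤ C * h ^ s * ‖(cellCenter h i : E d)‖ ^ (-γ) := by
  have hd0 : (0 : ℝ) < d := by exact_mod_cast hd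
  obtain ⟨C₁, hC₁0, hC₁⟩ := exists_psi_diff_bounds hd0 hγ0 hγ2 hs0 hs2 hK hu
  refine ⟨2 ^ d * C₁, by positivity, fun h x i hh hi => ?_⟩
  have hcn : h ≤ ‖(cellCenter h i : E d)‖ := le_norm_of_mem_cell hh hi (cellCenter_mem hh i)
  set T := (∑ m ∈ multiIdx d 2, psi γ u x (gridPt h (i + m)))
    - 2 ^ d * psi γ u x (cellCenter h i) with hT
  have e : 2 * T = ∑ m ∈ multiIdx d 2, (psi γ u x (gridPt h (i + m))
      + psi γ u x (gridPt h (i + fun j => 1 - m j)) - 2 * psi γ u x (cellCenter h i)) := by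
    rw [Finset.sum_sub_distrib, Finset.sum_add_distrib,
      sum_multiIdx_two_reflect fun m => psi γ u x (gridPt h (i + m)), Finset.sum_const,
      card_multiIdx, hT, nsmul_eq_mul]
    push_cast
    ring
  have hT2 : |2 * T| ≤ 2 ^ d * (C₁ * h ^ s * ‖(cellCenter h i : E d)‖ ^ (-γ)) := by
    rw [e]
    refine abs_sum_multiIdx_two_le fun m hm => ?_
    obtain ⟨e1, e2, n1, n2, n3⟩ := pair_mem_cell hh hi (gridPt_add_mem_cell hh i hm)
    have := (hC₁ h x (cellCenter h i) _ hh hcn n1 n2 n3).1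
    rw [e1, e2] at this
    rw [gridPt_add_reflect h i hm]
    exact this
  rw [abs_mul, abs_two] at hT2
  rw [mul_assoc, mul_assoc, ← mul_assoc C₁]
  linarith [abs_nonneg T]

/-- Reflection in the centre preserves the cell and the measure, so twice the error is the integral
of the symmetrized error density. -/
lemma exists_integral_sub_center_bound {d : ℕ} (hd : 1 ≤ d) {α γ s : ℝ} (hα : 0 < α)
    (hγα : α < γ) (hγ2 : γ ≤ 2) (hs0 : 0 < s) (hs2 : s ≤ 2) {u : E d → ℝ} {K : ℝ} (hK : 0 ≤ K)
    (hu : HasSymmDiffBound s K u) (hG : ∀ x, Integrable (symmIntegrand α u x)) :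
    ∃ C : ℝ, 0 ≤ C ∧ ∀ (h : ℝ) (x : E d) (i : Fin d → ℕ), 0 < h → i ≠ 0 →
      |(∫ ξ in cell h i, symmIntegrand α u x ξ)
        - psi γ u x (cellCenter h i) * cellWeight α γ h i|
        ≤ C * h ^ s * ∫ ξ in cell h i, ‖ξ‖ ^ (-((d : ℝ) + α)) := by
  have hd0 : (0 : ℝ) < d := by exact_mod_cast hd
  have hγ0 : 0 < γ := hα.trans hγα
  obtain ⟨C₂, hC₂0, hC₂⟩ := exists_error_density_bounds (α := α) hd0 hγ0.le hγ2 hs0 hs2 hK hu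
  refine ⟨C₂, hC₂0, fun h x i hh hi => ?_⟩
  have hcn : h ≤ ‖(cellCenter h i : E d)‖ := le_norm_of_mem_cell hh hi (cellCenter_mem hh i)
  have hω := integrableOn_cell_weight hd hγα hh i
  have hP := integrableOn_cell_norm_rpow hd hα hh hi
  let g : E d → ℝ := fun ξ =>
    (psi γ u x ξ - psi γ u x (cellCenter h i)) * ‖ξ‖ ^ (γ - ((d : ℝ) + α))
  have hgG : Set.EqOn (fun ξ => symmIntegrand α u x ξ
      - psi γ u x (cellCenter h i) * ‖ξ‖ ^ (γ - ((d : ℝ) + α))) g (cell h i) := fun ξ hξ => by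
    simp only [g]
    rw [symmIntegrand_eq_psi_mul α γ u x (hh.trans_le (le_norm_of_mem_cell hh hi hξ))]
    ring
  have hgint : IntegrableOn g (cell h i) :=
    IntegrableOn.congr_fun ((hG x).integrableOn.sub (hω.const_mul _)) hgG (measurableSet_cell h i)
  have hgval : ∫ ξ in cell h i, g ξ = (∫ ξ in cell h i, symmIntegrand α u x ξ)
      - psi γ u x (cellCenter h i) * cellWeight α γ h i := by
    rw [← setIntegral_congr_fun (measurableSet_cell h i) hgG,
      integral_sub (hG x).integrableOn (hω.const_mul _), integral_const_mul, cellWeight]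
  have e : 2 * ∫ ξ in cell h i, g ξ
      = ∫ ξ in cell h i, (g ξ + g (cellCenter h i + cellCenter h i - ξ)) := by
    rw [integral_add hgint (integrableOn_cell_reflect hgint), integral_cell_reflect, two_mul]
  have hbound : |2 * ∫ ξ in cell h i, g ξ|
      ≤ C₂ * h ^ s * ∫ ξ in cell h i, ‖ξ‖ ^ (-((d : ℝ) + α)) := by
    rw [e, ← integral_const_mul, ← Real.norm_eq_abs]
    refine norm_integral_le_of_norm_le (hP.const_mul _) ?_
    refine (ae_restrict_mem (measurableSet_cell h i)).mono fun ξ hξ => ?_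
    obtain ⟨e1, e2, n1, n2, n3⟩ := pair_mem_cell hh hi hξ
    have := hC₂ h x (cellCenter h i) _ hh hcn n1 n2 n3
    rw [e1, e2] at this
    exact this
  rw [abs_mul, abs_two, hgval] at hbound
  linarith [abs_nonneg ((∫ ξ in cell h i, symmIntegrand α u x ξ)
    - psi γ u x (cellCenter h i) * cellWeight α γ h i)]

lemma cellWeight_nonneg {d : ℕ} (α γ h : ℝ) (i : Fin d → ℕ) : 0 ≤ cellWeight α γ h i :=
  integral_nonneg fun ξ => Real.rpow_nonneg (norm_nonneg ξ) _

lemma exists_cell_error_bound {d : ℕ} (hd : 1 ≤ d) {α γ s : ℝ} (hα : 0 < α) (hγα : α < γ)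
    (hγ2 : γ ≤ 2) (hs0 : 0 < s) (hs2 : s ≤ 2) {u : E d → ℝ} {K : ℝ} (hK : 0 ≤ K)
    (hu : HasSymmDiffBound s K u) (hG : ∀ x, Integrable (symmIntegrand α u x)) :
    ∃ C : ℝ, 0 ≤ C ∧ ∀ (h : ℝ) (x : E d) (i : Fin d → ℕ), 0 < h → i ≠ 0 →
      |2 ^ d * (∫ ξ in cell h i, symmIntegrand α u x ξ)
        - (∑ m ∈ multiIdx d 2, psi γ u x (gridPt h (i + m))) * cellWeight α γ h i|
        ≤ C * h ^ s * ∫ ξ in cell h i, ‖ξ‖ ^ (-((d : ℝ) + α)) := by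
  have hγ0 : 0 < γ := hα.trans hγα
  obtain ⟨C₁, hC₁0, hC₁⟩ := exists_vertex_sum_bound hd hγ0.le hγ2 hs0 hs2 hK hu
  obtain ⟨C₂, hC₂0, hC₂⟩ := exists_integral_sub_center_bound hd hα hγα hγ2 hs0 hs2 hK hu hG
  obtain ⟨C₃, hC₃0, hC₃⟩ := exists_center_rpow_mul_weight_le hd hα hγα
  refine ⟨2 ^ d * C₂ + C₁ * C₃, by positivity, fun h x i hh hi => ?_⟩
  have b1 := hC₁ h x i hh hi
  have b2 := hC₂ h x i hh hi
  have b3 : ‖(cellCenter h i : E d)‖ ^ (-γ) * cellWeight α γ h i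
      ≤ C₃ * ∫ ξ in cell h i, ‖ξ‖ ^ (-((d : ℝ) + α)) := hC₃ h i hh hi
  have hW := cellWeight_nonneg α γ h i
  generalize (∫ ξ in cell h i, ‖ξ‖ ^ (-((d : ℝ) + α))) = J at *
  generalize cellWeight α γ h i = W at *
  generalize (∫ ξ in cell h i, symmIntegrand α u x ξ) = I at *
  generalize (∑ m ∈ multiIdx d 2, psi γ u x (gridPt h (i + m))) = V at *
  generalize psi γ u x (cellCenter h i) = p at *
  generalize ‖(cellCenter h i : E d)‖ ^ (-γ) = c at *
  have hs : 0 ≤ h ^ s := by positivity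
  have hTW : |(V - 2 ^ d * p) * W| ≤ C₁ * C₃ * h ^ s * J := by
    rw [abs_mul, abs_of_nonneg hW]
    calc |V - 2 ^ d * p| * W ≤ C₁ * h ^ s * c * W := by gcongr
      _ = C₁ * h ^ s * (c * W) := by ring
      _ ≤ C₁ * h ^ s * (C₃ * J) := by gcongr
      _ = _ := by ring
  have hgb : |2 ^ d * (I - p * W)| ≤ 2 ^ d * (C₂ * h ^ s * J) := by
    rw [abs_mul, abs_of_pos (by positivity : (0 : ℝ) < 2 ^ d)]
    gcongr
  have hfin : 2 ^ d * I - V * W = 2 ^ d * (I - p * W) - (V - 2 ^ d * p) * W := by ring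
  rw [hfin]
  refine (abs_sub _ _).trans ?_
  linarith

/-! ### Partition of the positive orthant -/

/-- The half-open version of the cell `I_i`. -/
def halfOpenCell {d : ℕ} (h : ℝ) (i : Fin d → ℕ) : Set (E d) :=
  {ξ | ∀ j, (i j : ℝ) * h ≤ ξ j ∧ ξ j < ((i j : ℝ) + 1) * h}

lemma measurableSet_halfOpenCell {d : ℕ} (h : ℝ) (i : Fin d → ℕ) :
    MeasurableSet (halfOpenCell h i : Set (E d)) := by
  have : (halfOpenCell h i : Set (E d))
      = ⋂ j, {ξ : E d | (i j : ℝ) * h ≤ ξ j} ∩ {ξ : E d | ξ j < ((i j : ℝ) + 1) * h} := by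
    ext
    simp [halfOpenCell]
  rw [this]
  exact MeasurableSet.iInter fun j => (measurableSet_le measurable_const (measurable_coord j)).inter
    (measurableSet_lt (measurable_coord j) measurable_const)

lemma halfOpenCell_subset_cell {d : ℕ} (h : ℝ) (i : Fin d → ℕ) :
    (halfOpenCell h i : Set (E d)) ⊆ cell h i := fun _ hξ j => ⟨(hξ j).1, (hξ j).2.le⟩

lemma halfOpenCell_ae_eq_cell {d : ℕ} (h : ℝ) (i : Fin d → ℕ) :
    (halfOpenCell h i : Set (E d)) =ᵐ[volume] (cell h i : Set (E d)) := by
  refine eventuallyEq_set.2 ?_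
  filter_upwards [ae_coord_ne fun j => ((i j : ℝ) + 1) * h] with ξ hξ
  exact ⟨fun h1 => halfOpenCell_subset_cell h i h1,
    fun h1 j => ⟨(h1 j).1, lt_of_le_of_ne (h1 j).2 (hξ j)⟩⟩

lemma pairwiseDisjoint_halfOpenCell {d : ℕ} {h : ℝ} (hh : 0 < h) (S : Set (Fin d → ℕ)) :
    S.PairwiseDisjoint fun i => (halfOpenCell h i : Set (E d)) := by
  intro i _ k _ hne
  refine Set.disjoint_left.2 fun ξ h1 h2 => hne ?_
  ext j
  have h3 : (i j : ℝ) < (k j : ℝ) + 1 :=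
    lt_of_mul_lt_mul_right ((h1 j).1.trans_lt (h2 j).2) hh.le
  have h4 : (k j : ℝ) < (i j : ℝ) + 1 :=
    lt_of_mul_lt_mul_right ((h2 j).1.trans_lt (h1 j).2) hh.le
  norm_cast at h3 h4
  omega

/-- Closed cells share faces; the half-open ones are disjoint and differ from them by null sets. -/
lemma sum_integral_cell {d : ℕ} {h : ℝ} (hh : 0 < h) (S : Finset (Fin d → ℕ)) {g : E d → ℝ}
    (hg : ∀ i ∈ S, IntegrableOn g (cell h i)) :
    ∑ i ∈ S, ∫ ξ in cell h i, g ξ = ∫ ξ in ⋃ i ∈ S, halfOpenCell h i, g ξ := by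
  rw [integral_biUnion_finset S (fun i _ => measurableSet_halfOpenCell h i)
    (pairwiseDisjoint_halfOpenCell hh _)
    fun i hi => (hg i hi).mono_set (halfOpenCell_subset_cell h i)]
  exact Finset.sum_congr rfl fun i _ => (setIntegral_congr_set (halfOpenCell_ae_eq_cell h i)).symm

lemma biUnion_halfOpenCell {d N : ℕ} {h : ℝ} (hh : 0 < h) :
    (⋃ i ∈ multiIdx d N, halfOpenCell h i : Set (E d)) = {ξ | ∀ j, 0 ≤ ξ j ∧ ξ j < N * h} := by
  ext ξ
  simp only [Set.mem_iUnion, exists_prop]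
  constructor
  · rintro ⟨i, hi, hξ⟩ j
    have h1 : ((i j : ℝ) + 1) ≤ N := by exact_mod_cast mem_multiIdx.1 hi j
    exact ⟨le_trans (by positivity) (hξ j).1, (hξ j).2.trans_le (by gcongr)⟩
  · intro hξ
    have h0 : ∀ j, 0 ≤ ξ j / h := fun j => div_nonneg (hξ j).1 hh.le
    refine ⟨fun j => ⌊ξ j / h⌋₊, mem_multiIdx.2 fun j => ?_, fun j => ⟨?_, ?_⟩⟩
    · rw [Nat.floor_lt (h0 j), div_lt_iff₀ hh]
      exact (hξ j).2
    · rw [← le_div_iff₀ hh]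
      exact Nat.floor_le (h0 j)
    · rw [← div_lt_iff₀ hh]
      exact Nat.lt_floor_add_one _

lemma measurableSet_farRegion (d : ℕ) (L : ℝ) : MeasurableSet (farRegion d L) := by
  have : farRegion d L = posOrthant d ∩ ⋃ j, {ξ : E d | L ≤ ξ j} := by
    ext
    simp [farRegion, posOrthant]
  rw [this]
  exact (measurableSet_posOrthant d).inter
    (MeasurableSet.iUnion fun j => measurableSet_le measurable_const (measurable_coord j))

lemma integral_posOrthant_eq {d N : ℕ} {h : ℝ} (hh : 0 < h) {g : E d → ℝ} (hg : Integrable g) :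
    ∫ ξ in posOrthant d, g ξ
      = (∑ i ∈ multiIdx d N, ∫ ξ in cell h i, g ξ) + ∫ ξ in farRegion d (N * h), g ξ := by
  rw [sum_integral_cell hh _ fun i _ => hg.integrableOn, ← setIntegral_union ?_
    (measurableSet_farRegion d _) hg.integrableOn hg.integrableOn, biUnion_halfOpenCell hh]
  · refine setIntegral_congr_set (eventuallyEq_set.2 ?_)
    filter_upwards [ae_coord_ne (fun _ : Fin d => 0)] with ξ hξ
    constructor
    · intro h1
      by_cases h2 : ∃ j, N * h ≤ ξ j
      · exact Or.inr ⟨h1, h2⟩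
      · push Not at h2
        exact Or.inl fun j => ⟨(h1 j).le, h2 j⟩
    · rintro (h1 | h1)
      · exact fun j => lt_of_le_of_ne (h1 j).1 (hξ j).symm
      · exact h1.1
  · rw [biUnion_halfOpenCell hh]
    refine Set.disjoint_left.2 fun ξ h1 h2 => ?_
    obtain ⟨-, j, hj⟩ := h2
    exact absurd (h1 j).2 (not_lt.2 hj)

/-- The half-open cells off the origin are disjoint and lie in `h ≤ ‖ξ‖`, whence a bound free of the
number of cells. -/
lemma sum_integral_cell_norm_rpow_le {d : ℕ} (hd : 1 ≤ d) {α : ℝ} (hα : 0 < α) {h : ℝ} (hh : 0 < h)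
    (N : ℕ) :
    ∑ i ∈ (multiIdx d N).filter (fun i => i ≠ 0), ∫ ξ in cell h i, ‖(ξ : E d)‖ ^ (-((d : ℝ) + α))
      ≤ ∫ ξ in {ξ : E d | h ≤ ‖ξ‖}, ‖ξ‖ ^ (-((d : ℝ) + α)) := by
  rw [sum_integral_cell hh _ fun i hi =>
    integrableOn_cell_norm_rpow hd hα hh (Finset.mem_filter.1 hi).2]
  refine setIntegral_mono_set (integrableOn_norm_rpow_le hd hα hh)
    (ae_of_all _ fun ξ => Real.rpow_nonneg (norm_nonneg ξ) _) (LE.le.eventuallyLE ?_)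
  exact Set.iUnion₂_subset fun i hi ξ hξ =>
    le_norm_of_mem_cell hh (Finset.mem_filter.1 hi).2 (halfOpenCell_subset_cell h i hξ)

/-! ### The far region -/

lemma le_maxSide {d : ℕ} (a b : Fin d → ℝ) (j : Fin d) : b j - a j ≤ maxSide a b :=
  le_ciSup (f := fun j => b j - a j) (Set.finite_range _).bddAbove j

lemma maxSide_pos {d : ℕ} (hd : 1 ≤ d) {a b : Fin d → ℝ} (hab : ∀ j, a j < b j) :
    0 < maxSide a b :=
  (sub_pos.2 (hab ⟨0, hd⟩)).trans_le (le_maxSide a b _)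

/-- Some coordinate moves by at least the longest side, so every shifted point leaves the open box,
whatever the signs. -/
lemma signSum_eq_of_mem_farRegion {d : ℕ} {a b : Fin d → ℝ} {u : E d → ℝ}
    (hsupp : ∀ x, x ∉ box a b → u x = 0) {x ξ : E d} (hx : x ∈ box a b)
    (hξ : ξ ∈ farRegion d (maxSide a b)) : signSum u x ξ = -(2 ^ d * u x) := by
  obtain ⟨-, j, hj⟩ := hξ
  have h1 := le_maxSide a b j
  obtain ⟨h2, h3⟩ := hx j
  rw [signSum, Finset.sum_eq_zero, zero_sub]
  refine fun σ _ => hsupp _ fun hmem => ?_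
  obtain ⟨h4, h5⟩ := hmem j
  rw [PiLp.add_apply, signFlip_apply] at h4 h5
  rcases neg_one_pow_eq_or ℝ (σ j) with h | h <;> rw [h] at h4 h5 <;> linarith

lemma integral_farRegion_symmIntegrand {d : ℕ} {a b : Fin d → ℝ} (α : ℝ) {u : E d → ℝ}
    (hsupp : ∀ x, x ∉ box a b → u x = 0) {x : E d} (hx : x ∈ box a b) :
    ∫ ξ in farRegion d (maxSide a b), symmIntegrand α u x ξ
      = -(2 ^ d * u x) * ∫ ξ in farRegion d (maxSide a b), ‖ξ‖ ^ (-((d : ℝ) + α)) := by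
  rw [← integral_const_mul]
  refine setIntegral_congr_fun (measurableSet_farRegion d _) fun ξ hξ => ?_
  rw [symmIntegrand, signSum_eq_of_mem_farRegion hsupp hx hξ, Real.rpow_neg (norm_nonneg _),
    div_eq_mul_inv]

lemma exists_bound_of_support {d : ℕ} {a b : Fin d → ℝ} {u : E d → ℝ} (hc : Continuous u)
    (hsupp : ∀ x, x ∉ box a b → u x = 0) : ∃ M : ℝ, ∀ y, |u y| ≤ M := by
  have hcs : HasCompactSupport u := by
    refine HasCompactSupport.of_support_subset_isCompact
      (isCompact_closedBall (0 : E d) (d * ∑ j, (|a j| + |b j|))) fun x hx => ?_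
    have hxb : x ∈ box a b := by
      by_contra h
      exact hx (hsupp x h)
    rw [mem_closedBall_zero_iff]
    refine norm_le_of_coord_le (Finset.sum_nonneg fun j _ => by positivity) fun j => ?_
    have h1 : |a j| + |b j| ≤ ∑ j, (|a j| + |b j|) :=
      Finset.single_le_sum (f := fun j => |a j| + |b j|) (fun j _ => by positivity)
        (Finset.mem_univ j)
    obtain ⟨h2, h3⟩ := hxb j
    rw [abs_le]
    constructor <;> linarith [neg_abs_le (a j), le_abs_self (b j), abs_nonneg (a j),
      abs_nonneg (b j)]
  obtain ⟨M, hM⟩ := hc.bounded_above_of_compact_support hcs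
  exact ⟨M, hM⟩

/-! ### The cell at the origin -/

lemma cell_zero_subset_ball {d : ℕ} {h : ℝ} (hh : 0 < h) :
    (cell h (0 : Fin d → ℕ) : Set (E d)) ⊆ Metric.ball 0 (((d : ℝ) + 1) * h) := by
  have := cell_subset_ball (d := d) (n := 1) (i := 0) hh fun j => by simp
  convert! this using 2
  push_cast
  ring

lemma exists_integral_cell_zero_norm_rpow_le {d : ℕ} (hd : 1 ≤ d) {e : ℝ} (he : 0 < e) :
    ∃ C : ℝ, 0 ≤ C ∧ ∀ h : ℝ, 0 < h →
      IntegrableOn (fun ξ : E d => ‖ξ‖ ^ (e - (d : ℝ))) (cell h 0) ∧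
      ∫ ξ in cell h (0 : Fin d → ℕ), ‖(ξ : E d)‖ ^ (e - (d : ℝ)) ≤ C * h ^ e := by
  obtain ⟨C, hC0, hC⟩ := exists_integral_ball_norm_rpow hd he
  refine ⟨C * ((d : ℝ) + 1) ^ e, by positivity, fun h hh => ?_⟩
  have hR : 0 < ((d : ℝ) + 1) * h := by positivity
  have hint := integrableOn_ball_norm_rpow hd he hR
  refine ⟨hint.mono_set (cell_zero_subset_ball hh), ?_⟩
  rw [mul_assoc, ← Real.mul_rpow (by positivity) hh.le, ← hC _ hR]
  exact setIntegral_mono_set hint (ae_of_all _ fun ξ => Real.rpow_nonneg (norm_nonneg ξ) _)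
    (LE.le.eventuallyLE (cell_zero_subset_ball hh))

lemma exists_integral_cell_zero_bound {d : ℕ} (hd : 1 ≤ d) {α ε K : ℝ} (hα : 0 < α) (hε : 0 < ε)
    (hK : 0 ≤ K) {u : E d → ℝ} (hu : HasSymmDiffBound (α + ε) K u) :
    ∃ C : ℝ, 0 ≤ C ∧ ∀ (h : ℝ) (x : E d), 0 < h →
      |∫ ξ in cell h (0 : Fin d → ℕ), symmIntegrand α u x ξ| ≤ C * h ^ ε := by
  obtain ⟨C, hC0, hC⟩ := exists_integral_cell_zero_norm_rpow_le hd hε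
  refine ⟨2 ^ d * K * C, by positivity, fun h x hh => ?_⟩
  obtain ⟨hint, hle⟩ := hC h hh
  rw [← Real.norm_eq_abs]
  refine (norm_integral_le_of_norm_le (hint.const_mul (2 ^ d * K)) (ae_of_all _ fun ξ =>
    abs_symmIntegrand_le hd hα hε hu x ξ)).trans ?_
  rw [integral_const_mul, mul_assoc _ C]
  gcongr

lemma abs_originCoeff_le {d : ℕ} (hd : 1 ≤ d) (γ : ℝ) (m : Fin d → ℕ) :
    |originCoeff γ m| ≤ 2 ^ d := by
  have h1 : (1 : ℝ) ≤ 2 ^ d := one_le_pow₀ (by norm_num)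
  have hd' : (1 : ℝ) ≤ d := by exact_mod_cast hd
  rw [originCoeff]
  split_ifs
  · simpa using h1
  · rw [abs_of_nonneg (by positivity)]
    exact div_le_self (by positivity) hd'
  · simp

lemma abs_psi_gridPt_le {d : ℕ} {γ s K : ℝ} (hγ : 0 ≤ γ) (hs : 0 < s) (hK : 0 ≤ K) {u : E d → ℝ}
    (hu : HasSymmDiffBound s K u) {h : ℝ} (hh : 0 < h) (x : E d) {m : Fin d → ℕ}
    (hm : m ∈ multiIdx d 2) (hm0 : m ≠ 0) :
    |psi γ u x (gridPt h m)| ≤ 2 ^ d * K * (d : ℝ) ^ s * (h ^ s / h ^ γ) := by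
  have hle : h ≤ ‖(gridPt h m : E d)‖ := by
    obtain ⟨j, hj⟩ := Function.ne_iff.1 hm0
    refine le_norm_of_coord_le j ?_
    have h1 : (1 : ℝ) ≤ m j := by exact_mod_cast Nat.one_le_iff_ne_zero.2 hj
    simp only [gridPt]
    nlinarith
  have hge : ‖(gridPt h m : E d)‖ ≤ d * h := by
    have := norm_le_of_mem_cell (n := 1) hh (by simp) (gridPt_add_mem_cell hh (0 : Fin d → ℕ) hm)
    simpa using this
  rw [psi_eq_signSum_div, abs_div, abs_of_nonneg (Real.rpow_nonneg (norm_nonneg _) _)]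
  calc |signSum u x (gridPt h m)| / ‖(gridPt h m : E d)‖ ^ γ
      ≤ 2 ^ d * (K * (d * h) ^ s) / h ^ γ := by
        gcongr
        refine (hu.abs_signSum_le hs x _).trans ?_
        gcongr
    _ = _ := by
        rw [Real.mul_rpow (by positivity) hh.le]
        ring

/-- Only boundedness of the coefficients matters. The quotients are `O(h ^ (α + ε - γ))` and the
weight is `O(h ^ (γ - α))`, so `γ` cancels. -/
lemma exists_origin_term_bound {d : ℕ} (hd : 1 ≤ d) {α ε γ K : ℝ} (hα : 0 < α) (hε : 0 < ε)
    (hγα : α < γ) (hK : 0 ≤ K) {u : E d → ℝ} (hu : HasSymmDiffBound (α + ε) K u) :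
    ∃ C : ℝ, 0 ≤ C ∧ ∀ (h : ℝ) (x : E d), 0 < h →
      |(∑ m ∈ (multiIdx d 2).filter (fun m => m ≠ 0),
          originCoeff γ m * psi γ u x (gridPt h m)) * cellWeight α γ h (0 : Fin d → ℕ)|
        ≤ C * h ^ ε := by
  obtain ⟨C, hC0, hC⟩ := exists_integral_cell_zero_norm_rpow_le hd (sub_pos.2 hγα)
  set B := 2 ^ d * (2 ^ d * K * (d : ℝ) ^ (α + ε)) with hB
  have hB0 : 0 ≤ B := by positivity
  refine ⟨2 ^ d * B * C, by positivity, fun h x hh => ?_⟩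
  have hW : cellWeight α γ h (0 : Fin d → ℕ) ≤ C * h ^ (γ - α) := by
    have := (hC h hh).2
    rwa [show γ - α - (d : ℝ) = γ - ((d : ℝ) + α) by ring] at this
  have hsum : |∑ m ∈ (multiIdx d 2).filter (fun m => m ≠ 0),
      originCoeff γ m * psi γ u x (gridPt h m)| ≤ 2 ^ d * (B * (h ^ (α + ε) / h ^ γ)) := by
    rw [Finset.sum_filter]
    refine abs_sum_multiIdx_two_le fun m hm => ?_
    split_ifs with hm0
    · rw [abs_mul, hB, mul_assoc (2 ^ d : ℝ)]
      exact mul_le_mul (abs_originCoeff_le hd γ m)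
        (abs_psi_gridPt_le (hα.trans hγα).le (by linarith) hK hu hh x hm hm0) (abs_nonneg _)
        (by positivity)
    · rw [abs_zero]
      positivity
  rw [abs_mul, abs_of_nonneg (cellWeight_nonneg _ _ _ _)]
  calc _ ≤ 2 ^ d * (B * (h ^ (α + ε) / h ^ γ)) * (C * h ^ (γ - α)) :=
        mul_le_mul hsum hW (cellWeight_nonneg _ _ _ _) (by positivity)
    _ = 2 ^ d * B * C * (h ^ (α + ε) / h ^ γ * h ^ (γ - α)) := by ring
    _ = _ := by
        rw [← Real.rpow_sub hh, ← Real.rpow_add hh]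
        ring_nf

/-! ### The convergence estimate -/

lemma IsHolderClass.exists_hasSymmDiffBound {d : ℕ} {α ε : ℝ} (hα0 : 0 < α) (hα2 : α < 2)
    (hε0 : 0 < ε) (hε1 : ε ≤ 1 + (⌊α⌋₊ : ℝ) - α) {u : E d → ℝ}
    (hu : IsHolderClass ⌊α⌋₊ (α - (⌊α⌋₊ : ℝ) + ε) u) :
    ∃ K : ℝ, 0 ≤ K ∧ HasSymmDiffBound (α + ε) K u := by
  rcases lt_or_ge α 1 with h | h
  · rw [Nat.floor_eq_zero.2 h] at hu
    refine hasSymmDiffBound_zero (by linarith) ?_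
    simpa using hu
  · have hf : ⌊α⌋₊ = 1 := (Nat.floor_eq_iff hα0.le).2 ⟨by simpa using h, by norm_num; linarith⟩
    rw [hf, Nat.cast_one] at hε1
    rw [hf, Nat.cast_one, sub_add_eq_add_sub] at hu
    exact hasSymmDiffBound_one (by linarith) (by linarith) hu

end

end FracFD

theorem theorem3 (d : ℕ) (hd : 1 ≤ d) (a b : Fin d → ℝ) (hab : ∀ j, a j < b j)
    (α : ℝ) (hα0 : 0 < α) (hα2 : α < 2)
    (ε : ℝ) (hε0 : 0 < ε) (hε1 : ε ≤ 1 + (⌊α⌋₊ : ℝ) - α)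
    (u : FracFD.E d → ℝ)
    (hsupp : ∀ x, x ∉ FracFD.box a b → u x = 0)
    (hu : FracFD.IsHolderClass ⌊α⌋₊ (α - (⌊α⌋₊ : ℝ) + ε) u)
    (γ : ℝ) (hγα : α < γ) (hγ2 : γ ≤ 2) :
    (∀ x ∈ FracFD.box a b,
      FracFD.HasFracLaplacianAt α u x (FracFD.fracLaplacian α u x)) ∧
    ∃ C : ℝ, 0 < C ∧ ∀ N : ℕ, 1 ≤ N → ∀ x ∈ FracFD.box a b,
      |FracFD.fracLaplacian α u x
          - FracFD.fdFracLaplacian α γ (FracFD.maxSide a b) N u x|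
        ≤ C * (FracFD.maxSide a b / N) ^ ε := by
  open FracFD in
  have hc : Continuous u := hu.1.continuous
  obtain ⟨M, hM⟩ := exists_bound_of_support hc hsupp
  obtain ⟨K, hK, hS⟩ := hu.exists_hasSymmDiffBound hα0 hα2 hε0 hε1
  have hs2 : α + ε ≤ 2 := by
    have : ⌊α⌋₊ ≤ 1 := Nat.le_of_lt_succ ((Nat.floor_lt hα0.le).2 (by exact_mod_cast hα2))
    have : (⌊α⌋₊ : ℝ) ≤ 1 := by exact_mod_cast this
    linarith
  have hG : ∀ x, Integrable (symmIntegrand α u x) :=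
    integrable_symmIntegrand hd hα0 hε0 hc hM hS
  have hlim := tendsto_truncFracLaplacian hd hα0 hε0 hc hM hS
  have hval : ∀ x, fracLaplacian α u x
      = -fracConst d α * ∫ y in posOrthant d, symmIntegrand α u x y := fun x => (hlim x).limUnder_eq
  refine ⟨fun x _ => ⟨fun r hr => integrableOn_fracIntegrand hd hα0 hc hM x hr, ?_⟩, ?_⟩
  · rw [hval]
    exact hlim x
  obtain ⟨C₁, hC₁0, hC₁⟩ :=
    exists_cell_error_bound hd hα0 hγα hγ2 (by linarith) hs2 hK hS hG
  obtain ⟨C₂, hC₂0, hC₂⟩ := exists_integral_norm_rpow_le hd hα0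
  obtain ⟨C₃, hC₃0, hC₃⟩ := exists_integral_cell_zero_bound hd hα0 hε0 hK hS
  obtain ⟨C₄, hC₄0, hC₄⟩ := exists_origin_term_bound hd hα0 hε0 hγα hK hS
  -- The three terms account for the cells off the origin, the exact integral at the origin and the
  -- quadrature at the origin; adding `1` makes the constant positive without examining `fracConst`.
  refine ⟨|fracConst d α| / 2 ^ d * (C₁ * C₂ + 2 ^ d * C₃ + C₄) + 1, by positivity,
    fun N hN x hx => ?_⟩
  have hN0 : (0 : ℝ) < N := by exact_mod_cast hN
  have hL := maxSide_pos hd hab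
  set L := maxSide a b with hLdef
  set h := L / N with hh
  have hh0 : 0 < h := by positivity
  have hNh : N * h = L := by
    rw [hh]
    field_simp
  have hzero : (0 : Fin d → ℕ) ∈ multiIdx d N := mem_multiIdx.2 fun j => hN
  have hfilter : (multiIdx d N).filter (fun i => i ≠ 0) = (multiIdx d N).erase 0 :=
    Finset.filter_ne' _ _
  set B := (∑ m ∈ (multiIdx d 2).filter (fun m => m ≠ 0),
    originCoeff γ m * psi γ u x (gridPt h m)) * cellWeight α γ h (0 : Fin d → ℕ) with hB
  set Z := ∫ ξ in cell h (0 : Fin d → ℕ), symmIntegrand α u x ξ with hZ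
  set R := ∑ i ∈ (multiIdx d N).filter (fun i => i ≠ 0),
    (2 ^ d * (∫ ξ in cell h i, symmIntegrand α u x ξ)
      - (∑ m ∈ multiIdx d 2, psi γ u x (gridPt h (i + m))) * cellWeight α γ h i) with hR
  -- The far-region contributions agree exactly and cancel, leaving only cell errors.
  have hdiff : fracLaplacian α u x - fdFracLaplacian α γ L N u x
      = -(fracConst d α / 2 ^ d) * (R + 2 ^ d * Z - B) := by
    have e := integral_posOrthant_eq (N := N) hh0 (hG x)
    rw [hNh, hLdef, integral_farRegion_symmIntegrand α hsupp hx,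
      ← Finset.add_sum_erase _ _ hzero, ← hfilter, ← hZ, ← hLdef] at e
    rw [hval, e, fdFracLaplacian, ← hh, ← hB, hR, Finset.sum_sub_distrib, ← Finset.mul_sum]
    field_simp
    ring
  have hRle : |R| ≤ C₁ * C₂ * h ^ ε := by
    calc |R| ≤ ∑ i ∈ (multiIdx d N).filter (fun i => i ≠ 0),
          C₁ * h ^ (α + ε) * ∫ ξ in cell h i, ‖(ξ : E d)‖ ^ (-((d : ℝ) + α)) :=
          (Finset.abs_sum_le_sum_abs _ _).trans (Finset.sum_le_sum fun i hi =>
            hC₁ h x i hh0 (Finset.mem_filter.1 hi).2)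
      _ ≤ C₁ * h ^ (α + ε) * (C₂ * h ^ (-α)) := by
          rw [← Finset.mul_sum, ← hC₂ h hh0]
          gcongr
          exact sum_integral_cell_norm_rpow_le hd hα0 hh0 N
      _ = C₁ * C₂ * (h ^ (α + ε) * h ^ (-α)) := by ring
      _ = _ := by
          rw [← Real.rpow_add hh0]
          ring_nf
  have hZle : |2 ^ d * Z| ≤ 2 ^ d * C₃ * h ^ ε := by
    rw [abs_mul, abs_of_pos (by positivity : (0 : ℝ) < 2 ^ d), mul_assoc]
    gcongr
    exact hC₃ h x hh0
  have hBle : |B| ≤ C₄ * h ^ ε := hC₄ h x hh0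
  have htot : |R + 2 ^ d * Z - B| ≤ (C₁ * C₂ + 2 ^ d * C₃ + C₄) * h ^ ε := by
    refine (abs_sub _ _).trans ?_
    linarith [abs_add_le R (2 ^ d * Z)]
  have hhε : 0 ≤ h ^ ε := by positivity
  rw [hdiff, abs_mul, abs_neg, abs_div, abs_of_pos (by positivity : (0 : ℝ) < 2 ^ d)]
  calc _ ≤ |fracConst d α| / 2 ^ d * ((C₁ * C₂ + 2 ^ d * C₃ + C₄) * h ^ ε) := by gcongr
    _ = |fracConst d α| / 2 ^ d * (C₁ * C₂ + 2 ^ d * C₃ + C₄) * h ^ ε := by ring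
    _ ≤ _ := by
        gcongr
        linarith
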